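/- For $n\ge 1$ let $F_n:[0,1]\to[0,\infty)$ be the zig-zag function that is continuous, with $F_n(0)=F_n(1)=0$, $F_n\big(\tfrac{2k+1}{2n}\big)=1$ for $0\le k\le n-1$, $F_n\big(\tfrac{k+1}{n}\big)=\tfrac12$ for $0\le k\le n-2$, and that is linear between consecutive points of this list. Let $f:[0,1]\to[0,\infty)$ be an excursion function, i.e. $f$ is continuous, $f(0)=f(1)=0$ and $f(t)>0$ for $0<t<1$. Suppose that for infinitely many $n\in\mathbb N$ there are infinitely many pairwise disjoint nontrivial intervals $[s_n^k,t_n^k]\subseteq[0,1]$, $k\in\mathbb N$, such that $$\sup_{s\in[s_n^k,t_n^k]}\left|f(s)-f(s_n^k)-\sqrt{t_n^k-s_n^k}\;F_n\!\left(\frac{s-s_n^k}{t_n^k-s_n^k}\right)\right|<\sqrt{t_n^k-s_n^k}\;2^{1-n}.$$ Let $d_f(s,t)=f(s)+f(t)-2\min_{u\in[s\wedge t,\,s\vee t]}f(u)$, let $T_f=[0,1]/\{d_f=0\}$ be the continuum tree, and let $\pi:[0,1]\to T_f$ be the projection. Let $Z=(Z(t))_{t\in[0,1]}$ be a centered Gaussian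 process with almost surely continuous sample paths and covariance $\mathbb E(Z(s)Z(t))=\min_{u\in[s\wedge t,\,s\vee t]}f(u)$. For $s,t\in[0,1]$ put $$D^o(s,t)=Z(s)+Z(t)-2\max\Big\{\min_{u\in[s,t]}Z(u),\ \min_{u\in[t,s]}Z(u)\Big\},$$ where $[s,t]:=[s,1]\cup[0,t]$ if $t<s$. For $x,y\in T_f$ put $D^o(x,y)=\min\{D^o(s,t):\pi(s)=x,\ \pi(t)=y\}$, and let $$D(s,t)=\inf\Big\{\sum_{i=0}^{m-1}D^o(u_i,u_{i+1})\Big\},$$ the infimum being over all finite sequences $u_0,\dots,u_m\in T_f$ with $u_0=\pi(s)$ and $u_m=\pi(t)$. Let $(\Phi(f),D)$ be the metric space obtained from the pseudometric space $([0,1],D)$ by identifying points at $D$-distance $0$. Then $(\Phi(f),D)$ is almost surely starry. Here a metric space $(X,d)$ is called starry if there are $A>1$ and $0<\eta<(A-1)/2$ such that for every $n\in\mathbb N$ there is some $A_n\ge A$ for which $X$ contains an $(A_n,\eta)$-approximate $n$-star. For $A'>1$, $0<\eta<1$ and $\eta<(A'-1)/2$, the space $X$ contains an $(A',\eta)$-approximate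 $n$-star if there are $\varrho>0$ and points $x_0,\dots,x_n\in X$ with $(A'-\eta)\varrho\le d(x_i,x_j)\le A'\varrho$ for all distinct $i,j\in\{1,\dots,n\}$, and $\varrho\le d(x_0,x_i)\le(1+\eta)\varrho$ for all $i\in\{1,\dots,n\}$. -/

import Mathlib

open MeasureTheory ProbabilityTheory

noncomputable section

/-! ### Starry metric spaces -/

/-- The metric space `X` contains an `(A, η)`-approximate `n`-star: a centre `x₀` and points
`x₁, …, x_n` (here indexed by `Fin n`). -/
def HasApproxStar (X : Type*) [MetricSpace X] (A η : ℝ) (n : ℕ) : Prop :=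
  1 < A ∧ 0 < η ∧ η < 1 ∧ η < (A - 1) / 2 ∧
    ∃ ρ : ℝ, 0 < ρ ∧ ∃ (x₀ : X) (x : Fin n → X),
      (∀ i j, i ≠ j → (A - η) * ρ ≤ dist (x i) (x j) ∧ dist (x i) (x j) ≤ A * ρ) ∧
      (∀ i, ρ ≤ dist x₀ (x i) ∧ dist x₀ (x i) ≤ (1 + η) * ρ)

/-- A metric space is starry if there are uniform `A > 1` and `0 < η < (A - 1) / 2` such that it
contains an `(Aₙ, η)`-approximate `n`-star with `Aₙ ≥ A` for every `n`. -/
def Starry (X : Type*) [MetricSpace X] : Prop :=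
  ∃ A η : ℝ, 1 < A ∧ 0 < η ∧ η < (A - 1) / 2 ∧
    ∀ n : ℕ, ∃ A' : ℝ, A ≤ A' ∧ HasApproxStar X A' η n

/-! ### Excursion functions and the zig-zag functions -/

/-- A (length one) excursion function: continuous on `[0,1]`, zero at both ends and positive in
between. -/
def IsExcursion (f : C(unitInterval, ℝ)) : Prop :=
  f 0 = 0 ∧ f 1 = 0 ∧ ∀ t : unitInterval, 0 < t → t < 1 → 0 < f t

/-- The zig-zag function `F_n` on `[0,1]`, for `n ≥ 1`. On the middle part,
`k = ⌊n x - 1/2⌋` is the index with `(2k+1)/(2n) ≤ x < (2k+3)/(2n)`. -/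
def zigzag (n : ℕ) (x : ℝ) : ℝ :=
  if x < 1 / (2 * n) then 2 * n * x
  else if (2 * n - 1) / (2 * n) ≤ x then -2 * n * x + 2 * n
  else if x < ((⌊n * x - 1 / 2⌋ : ℝ) + 1) / n then
    -n * x + (2 * (⌊n * x - 1 / 2⌋ : ℝ) + 3) / 2
  else n * x - (⌊n * x - 1 / 2⌋ : ℝ) - 1 / 2

/-- On the nontrivial interval `[s, t]`, the increment of `f` from `s` is uniformly within
`√(t - s) · 2^(1-n)` of the zig-zag function `F_n` rescaled to `[s, t]`. (Since all functions
involved are continuous and `[s, t]` is compact, the strict bound at every point is the strict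
bound on the supremum.) -/
def IsZigzagOn (f : C(unitInterval, ℝ)) (n : ℕ) (s t : unitInterval) : Prop :=
  s < t ∧ ∀ u ∈ Set.Icc s t,
    |f u - f s - √((t : ℝ) - s) * zigzag n (((u : ℝ) - s) / ((t : ℝ) - s))|
      < √((t : ℝ) - s) * (2 : ℝ) ^ (1 - (n : ℤ))

/-! ### The continuum tree -/

/-- The minimum of `f` between `s` and `t`, in either order. -/
def minBetween (f : C(unitInterval, ℝ)) (s t : unitInterval) : ℝ :=
  sInf (f '' Set.uIcc s t)

/-- The tree pseudometric `d_f` on `[0,1]`. -/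
def treeDist (f : C(unitInterval, ℝ)) (s t : unitInterval) : ℝ :=
  f s + f t - 2 * minBetween f s t

theorem bddBelow_image (f : C(unitInterval, ℝ)) (S : Set unitInterval) : BddBelow (f '' S) :=
  (isCompact_range f.continuous).bddBelow.mono (Set.image_subset_range _ _)

theorem minBetween_le (f : C(unitInterval, ℝ)) {s t u : unitInterval} (hu : u ∈ Set.uIcc s t) :
    minBetween f s t ≤ f u :=
  csInf_le (bddBelow_image f _) (Set.mem_image_of_mem _ hu)

theorem treeDist_self (f : C(unitInterval, ℝ)) (s : unitInterval) : treeDist f s s = 0 := by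
  simp only [treeDist, minBetween, Set.uIcc_self, Set.image_singleton, csInf_singleton]
  ring

theorem treeDist_comm (f : C(unitInterval, ℝ)) (s t : unitInterval) :
    treeDist f s t = treeDist f t s := by
  simp only [treeDist, minBetween, Set.uIcc_comm s t]
  ring

theorem treeDist_triangle (f : C(unitInterval, ℝ)) (r s t : unitInterval) :
    treeDist f r t ≤ treeDist f r s + treeDist f s t := by
  have h1 : minBetween f r s ≤ f s := minBetween_le f Set.right_mem_uIcc
  have h2 : minBetween f s t ≤ f s := minBetween_le f Set.left_mem_uIcc
  have h3 : min (minBetween f r s) (minBetween f s t) ≤ minBetween f r t := by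
    refine le_csInf (Set.Nonempty.image _ Set.nonempty_uIcc) ?_
    rintro _ ⟨u, hu, rfl⟩
    rcases Set.uIcc_subset_uIcc_union_uIcc (b := s) hu with h | h
    · exact (min_le_left _ _).trans (minBetween_le f h)
    · exact (min_le_right _ _).trans (minBetween_le f h)
  simp only [treeDist]
  rcases min_choice (minBetween f r s) (minBetween f s t) with h | h <;> rw [h] at h3 <;> linarith

/-- The interval `[0,1]`, to be equipped with the pseudometric `d_f`. -/
def TreeInterval (_f : C(unitInterval, ℝ)) : Type := unitInterval

instance treeIntervalPseudoMetric (f : C(unitInterval, ℝ)) : PseudoMetricSpace (TreeInterval f) where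
  dist := treeDist f
  dist_self := treeDist_self f
  dist_comm := treeDist_comm f
  dist_triangle := treeDist_triangle f

/-- The continuum tree `T_f`: the metric quotient of `([0,1], d_f)`, in which points at
`d_f`-distance zero are identified. -/
abbrev ContinuumTree (f : C(unitInterval, ℝ)) : Type := SeparationQuotient (TreeInterval f)

/-- The canonical projection `π : [0,1] → T_f`. -/
def treeProj (f : C(unitInterval, ℝ)) (s : unitInterval) : ContinuumTree f :=
  SeparationQuotient.mk (X := TreeInterval f) s

/-! ### The Brownian map metric built from a label function `z` -/

/-- The cyclic interval `[s, t]` in `[0,1]`: the usual one if `s ≤ t`, and `[s, 1] ∪ [0, t]` if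
`t < s`. -/
def cyclicIcc (s t : unitInterval) : Set unitInterval :=
  if s ≤ t then Set.Icc s t else Set.Ici s ∪ Set.Iic t

/-- `D°(s,t) = z s + z t - 2 max (min_{[s,t]} z, min_{[t,s]} z)`. -/
def labelDist (z : C(unitInterval, ℝ)) (s t : unitInterval) : ℝ :=
  z s + z t - 2 * max (sInf (z '' cyclicIcc s t)) (sInf (z '' cyclicIcc t s))

/-- `D°` on the tree `T_f`: the minimum of `D°` over representatives. -/
def treeLabelDist (f z : C(unitInterval, ℝ)) (x y : ContinuumTree f) : ℝ :=
  sInf {r | ∃ s t : unitInterval, treeProj f s = x ∧ treeProj f t = y ∧ labelDist z s t = r}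

/-- The pseudometric `D` on `[0,1]`: the infimum of the `D°`-lengths of the finite chains
`u 0, …, u n` in `T_f` from `π s` to `π t`. -/
def brownianDist (f z : C(unitInterval, ℝ)) (s t : unitInterval) : ℝ :=
  sInf {r | ∃ (n : ℕ) (u : ℕ → ContinuumTree f), u 0 = treeProj f s ∧ u n = treeProj f t ∧
    ∑ i ∈ Finset.range n, treeLabelDist f z (u i) (u (i + 1)) = r}

theorem left_mem_cyclicIcc (s t : unitInterval) : s ∈ cyclicIcc s t := by
  unfold cyclicIcc
  split_ifs with h
  · exact ⟨le_rfl, h⟩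
  · exact Or.inl Set.self_mem_Ici

theorem right_mem_cyclicIcc (s t : unitInterval) : t ∈ cyclicIcc s t := by
  unfold cyclicIcc
  split_ifs with h
  · exact ⟨h, le_rfl⟩
  · exact Or.inr Set.self_mem_Iic

theorem labelDist_nonneg (z : C(unitInterval, ℝ)) (s t : unitInterval) : 0 ≤ labelDist z s t := by
  have key : ∀ S : Set unitInterval, s ∈ S → t ∈ S → 2 * sInf (z '' S) ≤ z s + z t := by
    intro S hs ht
    have h1 := csInf_le (bddBelow_image z S) (Set.mem_image_of_mem z hs)
    have h2 := csInf_le (bddBelow_image z S) (Set.mem_image_of_mem z ht)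
    linarith
  have h1 := key _ (left_mem_cyclicIcc s t) (right_mem_cyclicIcc s t)
  have h2 := key _ (right_mem_cyclicIcc t s) (left_mem_cyclicIcc t s)
  simp only [labelDist]
  rcases max_choice (sInf (z '' cyclicIcc s t)) (sInf (z '' cyclicIcc t s)) with h | h <;>
    rw [h] <;> linarith

theorem labelDist_comm (z : C(unitInterval, ℝ)) (s t : unitInterval) :
    labelDist z s t = labelDist z t s := by
  simp only [labelDist, max_comm (sInf (z '' cyclicIcc s t))]
  ring

theorem treeLabelDist_nonneg (f z : C(unitInterval, ℝ)) (x y : ContinuumTree f) :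
    0 ≤ treeLabelDist f z x y := by
  apply Real.sInf_nonneg
  rintro _ ⟨s, t, -, -, rfl⟩
  exact labelDist_nonneg z s t

theorem treeLabelDist_comm (f z : C(unitInterval, ℝ)) (x y : ContinuumTree f) :
    treeLabelDist f z x y = treeLabelDist f z y x := by
  unfold treeLabelDist
  congr 1
  ext r
  constructor
  · rintro ⟨s, t, hs, ht, rfl⟩
    exact ⟨t, s, ht, hs, labelDist_comm z t s⟩
  · rintro ⟨s, t, hs, ht, rfl⟩
    exact ⟨t, s, ht, hs, labelDist_comm z t s⟩

theorem brownianDist_le (f z : C(unitInterval, ℝ)) {s t : unitInterval} (n : ℕ)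
    (u : ℕ → ContinuumTree f) (h0 : u 0 = treeProj f s) (hn : u n = treeProj f t) :
    brownianDist f z s t ≤ ∑ i ∈ Finset.range n, treeLabelDist f z (u i) (u (i + 1)) := by
  refine csInf_le ⟨0, ?_⟩ ⟨n, u, h0, hn, rfl⟩
  rintro _ ⟨m, v, -, -, rfl⟩
  exact Finset.sum_nonneg fun i _ => treeLabelDist_nonneg f z _ _

theorem le_brownianDist (f z : C(unitInterval, ℝ)) {s t : unitInterval} {c : ℝ}
    (h : ∀ (n : ℕ) (u : ℕ → ContinuumTree f), u 0 = treeProj f s → u n = treeProj f t →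
      c ≤ ∑ i ∈ Finset.range n, treeLabelDist f z (u i) (u (i + 1))) :
    c ≤ brownianDist f z s t := by
  refine le_csInf ⟨_, 1, fun i => if i = 0 then treeProj f s else treeProj f t, by simp, by simp,
    rfl⟩ ?_
  rintro _ ⟨n, u, h0, hn, rfl⟩
  exact h n u h0 hn

theorem brownianDist_self (f z : C(unitInterval, ℝ)) (s : unitInterval) :
    brownianDist f z s s = 0 := by
  apply le_antisymm
  · simpa using brownianDist_le f z (s := s) (t := s) 0 (fun _ => treeProj f s) rfl rfl
  · exact le_brownianDist f z fun n u _ _ =>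
      Finset.sum_nonneg fun i _ => treeLabelDist_nonneg f z _ _

theorem brownianDist_comm_le (f z : C(unitInterval, ℝ)) (s t : unitInterval) :
    brownianDist f z s t ≤ brownianDist f z t s := by
  refine le_brownianDist f z fun n u h0 hn => ?_
  refine (brownianDist_le f z n (fun i => u (n - i)) (by simpa using hn) (by simpa using h0)).trans
    (le_of_eq ?_)
  rw [← Finset.sum_range_reflect]
  refine Finset.sum_congr rfl fun i hi => ?_
  have hi' := Finset.mem_range.mp hi
  rw [treeLabelDist_comm]
  have e1 : n - (n - 1 - i + 1) = i := by omega
  have e2 : n - (n - 1 - i) = i + 1 := by omega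
  simp only [e1, e2]

theorem brownianDist_triangle (f z : C(unitInterval, ℝ)) (r s t : unitInterval) :
    brownianDist f z r t ≤ brownianDist f z r s + brownianDist f z s t := by
  rw [← sub_le_iff_le_add]
  refine le_brownianDist f z fun m v hv0 hvm => ?_
  rw [sub_le_iff_le_add, ← sub_le_iff_le_add']
  refine le_brownianDist f z fun n u hu0 hun => ?_
  rw [sub_le_iff_le_add']
  refine (brownianDist_le f z (m + n) (fun i => if i ≤ m then v i else u (i - m))
    (by simpa using hv0) ?_).trans (le_of_eq ?_)
  · by_cases hn : n = 0
    · subst hn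
      simp [hvm, ← hun, hu0]
    · simpa [hn] using hun
  · rw [Finset.sum_range_add]
    congr 1
    · refine Finset.sum_congr rfl fun i hi => ?_
      have hi' := Finset.mem_range.mp hi
      rw [if_pos (by omega), if_pos (by omega)]
    · refine Finset.sum_congr rfl fun i _ => ?_
      rw [if_neg (show ¬ m + i + 1 ≤ m by omega)]
      by_cases hi : i = 0
      · subst hi
        simp [hvm, ← hu0]
      · rw [if_neg (by omega)]
        congr 2 <;> omega

/-- The interval `[0,1]`, to be equipped with the pseudometric `D`. -/
def LabelledInterval (_f _z : C(unitInterval, ℝ)) : Type := unitInterval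

instance labelledIntervalPseudoMetric (f z : C(unitInterval, ℝ)) : PseudoMetricSpace (LabelledInterval f z) where
  dist := brownianDist f z
  dist_self := brownianDist_self f z
  dist_comm s t := le_antisymm (brownianDist_comm_le f z s t) (brownianDist_comm_le f z t s)
  dist_triangle := brownianDist_triangle f z

/-- The metric space obtained from the excursion `f` and the label function `z`: the metric
quotient of `([0,1], D)`. When `z` is a sample path of the Gaussian process on `T_f`, this is the
Brownian map `(Φ(f), D)`. -/
abbrev BrownianMap (f z : C(unitInterval, ℝ)) : Type := SeparationQuotient (LabelledInterval f z)

/-! ### The Gaussian labels -/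

/-- `Z` is a centered Gaussian process on `[0,1]` with covariance
`E (Z s * Z t) = min_{u between s and t} f u` and almost surely continuous sample paths. -/
structure IsTreeLabel {Ω : Type*} [MeasurableSpace Ω] (f : C(unitInterval, ℝ))
    (Z : unitInterval → Ω → ℝ) (P : Measure Ω) : Prop where
  gaussian : IsGaussianProcess Z P
  centered : ∀ t, ∫ ω, Z t ω ∂P = 0
  covariance : ∀ s t, ∫ ω, Z s ω * Z t ω ∂P = minBetween f s t
  continuous : ∀ᵐ ω ∂P, Continuous fun t => Z t ω

end

/-!
The proof has a geometric and a probabilistic half, joined by the notion of a *near-simplex*: `N`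
points whose mutual `D`-distances all lie in `[R / 4, R]` for some `R > 0`.

**Near-simplices of all sizes give stars** (`starry_of_nearSimplices`). By Ramsey's theorem one may
assume that the mutual distances are all close to one value `a`. Choose two times `s ≤ t` that
represent the same point of the tree, so that many of the points lie in `[s, t]` and many outside
(`exists_cut`). A jump from `[s, t]` to the outside goes around `s` or `t`, hence every path
between the two groups crosses one of the simple geodesics that start at `s` and at `t`
(`exists_crossing`); these are isometric to subsets of the line
(`OnSimpleGeodesic.brownianDist_le`). By the pigeonhole principle many points `x` on one side cross
at almost the same place `q` and at almost the same distance `α` from `q`, and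
`a ≤ d(x, x') ≤ 2 α` up to a small error. If `α ≤ 9 a / 10`, then `q` is the centre of a star. With
five targets on the other side, `α` cannot be close to `a` for all of them, since three of the
targets would then be almost equidistant points of a line (`exists_hub`).

**Near-simplices of all sizes exist almost surely.** Suppose that there is no near-simplex of
size `N` with probability at least `b > 0`. Without near-simplices the space is doubling
(`HasNoNearSimplex.card_le`): the number of `σ`-separated points is polynomial in `diameter / σ`.
On a stretch of time the diameter is at most four times the deviation of the labels. On the other
hand, `σ ^ 2`-separated points of the tree produce, after sorting them by height, many branches
with independent label increments (`IsTreeLabel.exists_separated`); by the second moment method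
many of these are at least `σ / 2`, and the cactus bound
(`IsExcursionInterval.le_brownianDist`) turns these branches into `σ`-separated points for `D`.
Hence a bound `M √δ` for the labels over a stretch where `f` varies by `δ` gives covering numbers
of the tree that are polynomial in `M` (`IsTreeLabel.exists_card_le`). Chaining turns these into a
bound for the labels that is only logarithmic in `M` (`IsTreeLabel.exists_deviation_le`), so `M`,
and then the covering numbers, are bounded by constants that depend on `N` and `b` only
(`IsTreeLabel.exists_uniform_card_le`). The peaks of a zig-zag with many teeth contradict this
(`IsZigzagOn.exists_window`). A single stretch for each of infinitely many `n` is enough.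
-/

/-! ### Cyclic intervals -/

/-- A cyclic interval contains one of the two cyclic intervals joining two of its points. -/
theorem cyclicIcc_subset_of_mem {x y p r : unitInterval} (hp : p ∈ cyclicIcc x y)
    (hr : r ∈ cyclicIcc x y) : cyclicIcc p r ⊆ cyclicIcc x y ∨ cyclicIcc r p ⊆ cyclicIcc x y := by
  have key : ∀ p r : unitInterval, p ∈ cyclicIcc x y → r ∈ cyclicIcc x y → p ≤ r →
      cyclicIcc p r ⊆ cyclicIcc x y ∨ cyclicIcc r p ⊆ cyclicIcc x y := by
    intro p r hp hr hpr
    by_cases hxy : x ≤ y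
    · left
      simp only [cyclicIcc, if_pos hxy, if_pos hpr] at hp hr ⊢
      exact Set.Icc_subset_Icc hp.1 hr.2
    · simp only [cyclicIcc, if_neg hxy, Set.mem_union, Set.mem_Ici, Set.mem_Iic, if_pos hpr]
        at hp hr ⊢
      rcases hp with hp | hp
      · exact Or.inl fun u hu => Or.inl (hp.trans hu.1)
      · rcases hr with hr | hr
        · by_cases hrp : r ≤ p
          · exact Or.inl fun u hu => Or.inr (hu.2.trans (hrp.trans hp))
          · right
            rw [if_neg hrp]
            rintro u (hu | hu)
            · exact Or.inl (hr.trans hu)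
            · exact Or.inr (le_trans hu hp)
        · exact Or.inl fun u hu => Or.inr (hu.2.trans hr)
  rcases le_total p r with h | h
  · exact key p r hp hr h
  · exact (key r p hr hp h).symm

/-- Concatenation of cyclic intervals at `e`, irrespective of their orientations. -/
theorem cyclicIcc_subset_union {p r e : unitInterval} {S T : Set unitInterval}
    (hp : cyclicIcc p e ⊆ S ∨ cyclicIcc e p ⊆ S) (hr : cyclicIcc r e ⊆ T ∨ cyclicIcc e r ⊆ T) :
    cyclicIcc p r ⊆ S ∪ T ∨ cyclicIcc r p ⊆ S ∪ T := by
  have mono : ∀ {A B : Set unitInterval}, A ⊆ S → B ⊆ T →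
      (cyclicIcc p r ⊆ A ∪ B ∨ cyclicIcc r p ⊆ A ∪ B) →
      (cyclicIcc p r ⊆ S ∪ T ∨ cyclicIcc r p ⊆ S ∪ T) := fun hA hB h =>
    h.imp (fun h => h.trans (Set.union_subset_union hA hB))
      (fun h => h.trans (Set.union_subset_union hA hB))
  rcases hp with hp | hp <;> rcases hr with hr | hr <;> refine mono hp hr ?_
  all_goals
    simp only [cyclicIcc, Set.subset_def, Set.mem_union]
    split_ifs <;> simp only [Set.mem_union, Set.mem_Icc, Set.mem_Ici, Set.mem_Iic] <;> grind

/-- Each of the two cyclic intervals joining a point of `(a, b)` to a point outside passes through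
`a` or `b`. -/
theorem endpoint_mem_cyclicIcc {a b s t : unitInterval} (hs : s ∈ Set.Ioo a b)
    (ht : t ∉ Set.Ioo a b) :
    (a ∈ cyclicIcc s t ∨ b ∈ cyclicIcc s t) ∧ (a ∈ cyclicIcc t s ∨ b ∈ cyclicIcc t s) := by
  obtain ⟨h1, h2⟩ := hs
  simp only [Set.mem_Ioo, not_and, not_lt] at ht
  constructor
  all_goals
    simp only [cyclicIcc]
    split_ifs <;> simp only [Set.mem_union, Set.mem_Icc, Set.mem_Ici, Set.mem_Iic] <;> grind

theorem isCompact_cyclicIcc (s t : unitInterval) : IsCompact (cyclicIcc s t) := by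
  unfold cyclicIcc
  split_ifs
  · exact isCompact_Icc
  · exact (isClosed_Ici.union isClosed_Iic).isCompact

/-! ### Elementary bounds for the label distance -/

/-- `D°(s, t)` is computed by the minimum of the labels on one of the two cyclic intervals. -/
theorem exists_labelDist_eq (z : C(unitInterval, ℝ)) (s t : unitInterval) :
    ∃ K q, (K = cyclicIcc s t ∨ K = cyclicIcc t s) ∧ q ∈ K ∧ (∀ u ∈ K, z q ≤ z u) ∧
      labelDist z s t = z s + z t - 2 * z q := by
  have key : ∀ K : Set unitInterval, IsCompact K → K.Nonempty →
      ∃ q ∈ K, (∀ u ∈ K, z q ≤ z u) ∧ sInf (z '' K) = z q := by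
    intro K hK hne
    obtain ⟨q, hq, h⟩ := hK.exists_sInf_image_eq hne z.continuous.continuousOn
    exact ⟨q, hq, fun u hu => h ▸ csInf_le (bddBelow_image z K) (Set.mem_image_of_mem z hu), h⟩
  rcases max_choice (sInf (z '' cyclicIcc s t)) (sInf (z '' cyclicIcc t s)) with h | h
  · obtain ⟨q, hq, hmin, he⟩ := key _ (isCompact_cyclicIcc s t) ⟨s, left_mem_cyclicIcc s t⟩
    exact ⟨_, q, Or.inl rfl, hq, hmin, by rw [labelDist, h, he]⟩
  · obtain ⟨q, hq, hmin, he⟩ := key _ (isCompact_cyclicIcc t s) ⟨t, left_mem_cyclicIcc t s⟩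
    exact ⟨_, q, Or.inr rfl, hq, hmin, by rw [labelDist, h, he]⟩

theorem labelDist_le_of_forall_le (z : C(unitInterval, ℝ)) {s t : unitInterval} {c : ℝ}
    (h : (∀ u ∈ cyclicIcc s t, c ≤ z u) ∨ ∀ u ∈ cyclicIcc t s, c ≤ z u) :
    labelDist z s t ≤ z s + z t - 2 * c := by
  have : c ≤ max (sInf (z '' cyclicIcc s t)) (sInf (z '' cyclicIcc t s)) := by
    rcases h with h | h
    · refine le_max_of_le_left (le_csInf ⟨_, Set.mem_image_of_mem z (left_mem_cyclicIcc s t)⟩ ?_)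
      rintro _ ⟨u, hu, rfl⟩
      exact h u hu
    · refine le_max_of_le_right (le_csInf ⟨_, Set.mem_image_of_mem z (left_mem_cyclicIcc t s)⟩ ?_)
      rintro _ ⟨u, hu, rfl⟩
      exact h u hu
  unfold labelDist
  linarith

theorem abs_sub_le_labelDist (z : C(unitInterval, ℝ)) (s t : unitInterval) :
    |z s - z t| ≤ labelDist z s t := by
  obtain ⟨K, q, hK, -, hmin, h⟩ := exists_labelDist_eq z s t
  have hs : z q ≤ z s := hmin s (by
    rcases hK with rfl | rfl
    exacts [left_mem_cyclicIcc s t, right_mem_cyclicIcc t s])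
  have ht : z q ≤ z t := hmin t (by
    rcases hK with rfl | rfl
    exacts [right_mem_cyclicIcc s t, left_mem_cyclicIcc t s])
  rw [h, abs_le]
  constructor <;> linarith

theorem treeProj_eq_iff (f : C(unitInterval, ℝ)) {s t : unitInterval} :
    treeProj f s = treeProj f t ↔ treeDist f s t = 0 :=
  SeparationQuotient.mk_eq_mk.trans Metric.inseparable_iff

theorem exists_treeProj_eq (f : C(unitInterval, ℝ)) (x : ContinuumTree f) :
    ∃ s, treeProj f s = x :=
  SeparationQuotient.surjective_mk x

theorem treeLabelDist_le (f z : C(unitInterval, ℝ)) (s t : unitInterval) :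
    treeLabelDist f z (treeProj f s) (treeProj f t) ≤ labelDist z s t := by
  refine csInf_le ⟨0, ?_⟩ ⟨s, t, rfl, rfl, rfl⟩
  rintro _ ⟨s, t, -, -, rfl⟩
  exact labelDist_nonneg z s t

theorem brownianDist_le_labelDist (f z : C(unitInterval, ℝ)) (s t : unitInterval) :
    brownianDist f z s t ≤ labelDist z s t := by
  refine (brownianDist_le f z 1 (fun i => if i = 0 then treeProj f s else treeProj f t)
    (by simp) (by simp)).trans ?_
  simpa using treeLabelDist_le f z s t

theorem brownianDist_comm (f z : C(unitInterval, ℝ)) (s t : unitInterval) :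
    brownianDist f z s t = brownianDist f z t s :=
  le_antisymm (brownianDist_comm_le f z s t) (brownianDist_comm_le f z t s)

theorem brownianDist_congr_left (f z : C(unitInterval, ℝ)) {s s' : unitInterval}
    (h : treeDist f s s' = 0) (t : unitInterval) : brownianDist f z s t = brownianDist f z s' t := by
  unfold brownianDist
  rw [(treeProj_eq_iff f).2 h]

theorem brownianDist_eq_zero (f z : C(unitInterval, ℝ)) {s t : unitInterval}
    (h : treeDist f s t = 0) : brownianDist f z s t = 0 := by
  rw [brownianDist_congr_left f z h, brownianDist_self]

theorem exists_labelDist_lt (f z : C(unitInterval, ℝ)) (x y : ContinuumTree f) {ε : ℝ}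
    (hε : 0 < ε) : ∃ s t, treeProj f s = x ∧ treeProj f t = y ∧
      labelDist z s t < treeLabelDist f z x y + ε := by
  obtain ⟨s, hs⟩ := exists_treeProj_eq f x
  obtain ⟨t, ht⟩ := exists_treeProj_eq f y
  obtain ⟨_, ⟨s, t, hs, ht, rfl⟩, h⟩ := exists_lt_of_csInf_lt
    (s := {r | ∃ s t, treeProj f s = x ∧ treeProj f t = y ∧ labelDist z s t = r})
    ⟨_, s, t, hs, ht, rfl⟩ (lt_add_of_pos_right _ hε)
  exact ⟨s, t, hs, ht, h⟩

/-- A chain of almost minimal length from a set `C` of times, saturated for the tree projection,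
to its complement contains a jump leaving `C`. -/
theorem exists_jump (f z : C(unitInterval, ℝ)) {C : Set unitInterval}
    (hC : ∀ s ∈ C, ∀ t, treeDist f s t = 0 → t ∈ C) {s t : unitInterval} (hs : s ∈ C)
    (ht : t ∉ C) {ε : ℝ} (hε : 0 < ε) :
    ∃ s₁ ∈ C, ∃ t₁ ∉ C, brownianDist f z s s₁ + labelDist z s₁ t₁ + brownianDist f z t₁ t
      ≤ brownianDist f z s t + ε := by
  obtain ⟨_, ⟨n, u, h0, hn, rfl⟩, hlt⟩ := exists_lt_of_csInf_lt
    (s := {r | ∃ (n : ℕ) (u : ℕ → ContinuumTree f), u 0 = treeProj f s ∧ u n = treeProj f t ∧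
      ∑ i ∈ Finset.range n, treeLabelDist f z (u i) (u (i + 1)) = r})
    ⟨_, 1, fun i => if i = 0 then treeProj f s else treeProj f t, by simp, by simp, rfl⟩
    (lt_add_of_pos_right (brownianDist f z s t) (half_pos hε))
  have hmem : ∀ p q, treeProj f p = treeProj f q → p ∈ C → q ∈ C := fun p q h hp =>
    hC p hp q ((treeProj_eq_iff f).1 h)
  obtain ⟨i, hi, ⟨p, hpC, hp⟩, hout⟩ : ∃ i < n, (∃ p ∈ C, treeProj f p = u i) ∧
      ∀ p ∈ C, treeProj f p ≠ u (i + 1) := by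
    by_contra! hcon
    have : ∀ i ≤ n, ∃ p ∈ C, treeProj f p = u i := by
      intro i
      induction i with
      | zero => exact fun _ => ⟨s, hs, h0.symm⟩
      | succ i ih => exact fun hi => hcon i (by omega) (ih (by omega))
    obtain ⟨p, hp, hpn⟩ := this n le_rfl
    exact ht (hmem p t (hpn.trans hn) hp)
  obtain ⟨s₁, t₁, hs₁, ht₁, hst⟩ := exists_labelDist_lt f z (u i) (u (i + 1)) (half_pos hε)
  refine ⟨s₁, hmem p s₁ (hp.trans hs₁.symm) hpC, t₁, fun h => hout t₁ h ht₁, ?_⟩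
  have hl : brownianDist f z s s₁ ≤ ∑ j ∈ Finset.range i, treeLabelDist f z (u j) (u (j + 1)) :=
    brownianDist_le f z i u h0 hs₁.symm
  have hr : brownianDist f z t₁ t ≤ ∑ j ∈ Finset.range (n - (i + 1)),
      treeLabelDist f z (u (i + 1 + j)) (u (i + 1 + j + 1)) :=
    brownianDist_le f z (n - (i + 1)) (fun j => u (i + 1 + j)) ht₁.symm
      (by rw [← hn]; congr 1; omega)
  have hsum : ∑ j ∈ Finset.range n, treeLabelDist f z (u j) (u (j + 1)) =
      ∑ j ∈ Finset.range i, treeLabelDist f z (u j) (u (j + 1)) +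
        treeLabelDist f z (u i) (u (i + 1)) + ∑ j ∈ Finset.range (n - (i + 1)),
      treeLabelDist f z (u (i + 1 + j)) (u (i + 1 + j + 1)) := by
    rw [← Finset.sum_range_succ, ← Finset.sum_range_add]
    congr 2
    omega
  linarith

/-- The labels `z` are compatible with `f` if they factor through the tree. -/
def LabelCompatible (f z : C(unitInterval, ℝ)) : Prop :=
  ∀ s t, treeDist f s t = 0 → z s = z t

theorem abs_sub_le_brownianDist {f z : C(unitInterval, ℝ)} (hz : LabelCompatible f z)
    (s t : unitInterval) : |z s - z t| ≤ brownianDist f z s t := by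
  refine le_of_forall_pos_le_add fun ε hε => ?_
  by_cases h : treeDist f s t = 0
  · rw [hz s t h, brownianDist_eq_zero f z h]
    simpa using hε.le
  refine le_brownianDist f z (fun n u h0 hn => ?_) |>.trans (le_add_of_nonneg_right hε.le)
  choose v hv using exists_treeProj_eq f
  -- Each jump costs at least the label difference, whichever representatives it uses.
  have hstep : ∀ x y, |z (v x) - z (v y)| ≤ treeLabelDist f z x y := by
    intro x y
    refine le_csInf ⟨_, v x, v y, hv x, hv y, rfl⟩ ?_
    rintro _ ⟨a, b, ha, hb, rfl⟩
    rw [hz (v x) a ((treeProj_eq_iff f).1 ((hv x).trans ha.symm)),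
      hz (v y) b ((treeProj_eq_iff f).1 ((hv y).trans hb.symm))]
    exact abs_sub_le_labelDist z a b
  have hchain : ∀ n, |z (v (u 0)) - z (v (u n))| ≤
      ∑ i ∈ Finset.range n, treeLabelDist f z (u i) (u (i + 1)) := by
    intro n
    induction n with
    | zero => simp
    | succ n ih =>
      rw [Finset.sum_range_succ]
      exact (abs_sub_le _ (z (v (u n))) _).trans (add_le_add ih (hstep _ _))
  have := hchain n
  rwa [h0, hn, hz (v (treeProj f s)) s ((treeProj_eq_iff f).1 (hv _)),
    hz (v (treeProj f t)) t ((treeProj_eq_iff f).1 (hv _))] at this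

/-! ### Excursions of `f` above a level -/

theorem le_minBetween (f : C(unitInterval, ℝ)) {s t : unitInterval} {c : ℝ}
    (h : ∀ u ∈ Set.uIcc s t, c ≤ f u) : c ≤ minBetween f s t := by
  refine le_csInf (Set.nonempty_uIcc.image f) ?_
  rintro _ ⟨u, hu, rfl⟩
  exact h u hu

theorem exists_minBetween_eq (f : C(unitInterval, ℝ)) (s t : unitInterval) :
    ∃ u ∈ Set.uIcc s t, minBetween f s t = f u :=
  isCompact_uIcc.exists_sInf_image_eq Set.nonempty_uIcc f.continuous.continuousOn

theorem minBetween_comm (f : C(unitInterval, ℝ)) (s t : unitInterval) :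
    minBetween f s t = minBetween f t s := by
  rw [minBetween, minBetween, Set.uIcc_comm]

theorem minBetween_self (f : C(unitInterval, ℝ)) (s : unitInterval) : minBetween f s s = f s := by
  simp [minBetween]

theorem treeDist_nonneg (f : C(unitInterval, ℝ)) (s t : unitInterval) : 0 ≤ treeDist f s t := by
  have h1 := minBetween_le f (Set.left_mem_uIcc (a := s) (b := t))
  have h2 := minBetween_le f (Set.right_mem_uIcc (a := s) (b := t))
  unfold treeDist
  linarith

theorem treeDist_eq_zero_of_le (f : C(unitInterval, ℝ)) {s t : unitInterval} (hst : s ≤ t)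
    (he : f s = f t) (h : ∀ u ∈ Set.Icc s t, f s ≤ f u) : treeDist f s t = 0 := by
  have h1 : f s ≤ minBetween f s t := le_minBetween f (by rwa [Set.uIcc_of_le hst])
  have h2 := minBetween_le f (Set.left_mem_uIcc (a := s) (b := t))
  unfold treeDist
  linarith

theorem le_of_treeDist_eq_zero (f : C(unitInterval, ℝ)) {s t u : unitInterval}
    (h : treeDist f s t = 0) (hu : u ∈ Set.uIcc s t) : f s ≤ f u ∧ f s = f t := by
  have h1 := minBetween_le f (Set.left_mem_uIcc (a := s) (b := t))
  have h2 := minBetween_le f (Set.right_mem_uIcc (a := s) (b := t))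
  have h3 := minBetween_le f hu
  unfold treeDist at h
  constructor <;> linarith

/-- The last time before `p` at which `f` takes the value `h`. -/
theorem exists_last_hitting (f : C(unitInterval, ℝ)) {p : unitInterval} {h : ℝ} (h0 : f 0 ≤ h)
    (hp : h ≤ f p) : ∃ a ≤ p, f a = h ∧ ∀ u, a < u → u ≤ p → h < f u := by
  have hcomp : IsCompact {u | u ≤ p ∧ f u ≤ h} :=
    (isClosed_Iic.inter (isClosed_le f.continuous continuous_const)).isCompact
  obtain ⟨a, ⟨hap, hah⟩, hmax⟩ := hcomp.exists_isGreatest ⟨0, unitInterval.nonneg', h0⟩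
  have hlast : ∀ u, a < u → u ≤ p → h < f u := fun u hau hup =>
    lt_of_not_ge fun hle => absurd (hmax ⟨hup, hle⟩) (not_le.2 hau)
  refine ⟨a, hap, le_antisymm hah ?_, hlast⟩
  obtain ⟨v, hv, hvh⟩ := intermediate_value_Icc hap f.continuous.continuousOn ⟨hah, hp⟩
  rcases hv.1.eq_or_lt with rfl | hlt
  · exact hvh.ge
  · exact absurd hvh (hlast v hlt hv.2).ne'

/-- The first time after `p` at which `f` takes the value `h`. -/
theorem exists_first_hitting (f : C(unitInterval, ℝ)) {p : unitInterval} {h : ℝ} (h1 : f 1 ≤ h)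
    (hp : h ≤ f p) : ∃ b ≥ p, f b = h ∧ ∀ u, p ≤ u → u < b → h < f u := by
  have hcomp : IsCompact {u | p ≤ u ∧ f u ≤ h} :=
    (isClosed_Ici.inter (isClosed_le f.continuous continuous_const)).isCompact
  obtain ⟨b, ⟨hpb, hbh⟩, hmin⟩ := hcomp.exists_isLeast ⟨1, unitInterval.le_one', h1⟩
  have hfirst : ∀ u, p ≤ u → u < b → h < f u := fun u hpu hub =>
    lt_of_not_ge fun hle => absurd (hmin ⟨hpu, hle⟩) (not_le.2 hub)
  refine ⟨b, hpb, le_antisymm hbh ?_, hfirst⟩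
  obtain ⟨v, hv, hvh⟩ := intermediate_value_Icc' hpb f.continuous.continuousOn ⟨hbh, hp⟩
  rcases hv.2.eq_or_lt with rfl | hlt
  · exact hvh.ge
  · exact absurd hvh (hfirst v hv.1 hlt).ne'

/-- `(a, b)` is an excursion interval of `f` strictly above the level `f a = f b`. -/
structure IsExcursionInterval (f : C(unitInterval, ℝ)) (a b : unitInterval) : Prop where
  lt : a < b
  eq : f a = f b
  above : ∀ u ∈ Set.Ioo a b, f a < f u

theorem IsExcursionInterval.treeDist_eq_zero {f : C(unitInterval, ℝ)} {a b : unitInterval}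
    (h : IsExcursionInterval f a b) : treeDist f a b = 0 := by
  refine treeDist_eq_zero_of_le f h.lt.le h.eq fun u hu => ?_
  rcases hu.1.eq_or_lt with rfl | h1
  · exact le_rfl
  rcases hu.2.eq_or_lt with rfl | h2
  · exact h.eq.le
  exact (h.above u ⟨h1, h2⟩).le

theorem exists_excursionInterval {f : C(unitInterval, ℝ)} (hf : IsExcursion f) {p : unitInterval}
    {h : ℝ} (h0 : 0 ≤ h) (hp : h < f p) :
    ∃ a b, IsExcursionInterval f a b ∧ p ∈ Set.Ioo a b ∧ f a = h := by
  obtain ⟨a, hap, ha, ha'⟩ := exists_last_hitting f (hf.1.trans_le h0) hp.le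
  obtain ⟨b, hbp, hb, hb'⟩ := exists_first_hitting f (hf.2.1.trans_le h0) hp.le
  have h1 : a < p := hap.lt_of_ne (by rintro rfl; exact hp.ne' ha)
  have h2 : p < b := lt_of_le_of_ne hbp (by rintro rfl; exact hp.ne' hb)
  refine ⟨a, b, ⟨h1.trans h2, ha.trans hb.symm, fun u hu => ?_⟩, ⟨h1, h2⟩, ha⟩
  rw [ha]
  rcases le_total u p with h | h
  · exact ha' u hu.1 h
  · exact hb' u h hu.2

/-- A branch of the tree: the times of an excursion interval form a saturated set. -/
theorem IsExcursionInterval.saturated {f : C(unitInterval, ℝ)} {a b : unitInterval}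
    (h : IsExcursionInterval f a b) {s t : unitInterval} (hs : s ∈ Set.Ioo a b)
    (hst : treeDist f s t = 0) : t ∈ Set.Ioo a b := by
  have hfs := h.above s hs
  constructor
  · by_contra! hta
    have := (le_of_treeDist_eq_zero f hst (Set.mem_uIcc_of_ge hta hs.1.le)).1
    linarith
  · by_contra! hbt
    have := (le_of_treeDist_eq_zero f hst (Set.mem_uIcc_of_le hs.2.le hbt)).1
    rw [← h.eq] at this
    linarith

/-- The cactus bound: to leave a branch of the tree, one has to go around its root, and so down to
the label of the root. -/
theorem IsExcursionInterval.le_brownianDist {f z : C(unitInterval, ℝ)} (hz : LabelCompatible f z)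
    {a b : unitInterval} (h : IsExcursionInterval f a b) {s t : unitInterval}
    (hs : s ∈ Set.Ioo a b) (ht : t ∉ Set.Ioo a b) :
    z s + z t - 2 * z a ≤ brownianDist f z s t := by
  refine le_of_forall_pos_le_add fun ε hε => ?_
  obtain ⟨s₁, hs₁, t₁, ht₁, hle⟩ := exists_jump f z (C := Set.Ioo a b)
    (fun s hs t hst => h.saturated hs hst) hs ht hε
  obtain ⟨K, q, hK, -, hmin, he⟩ := exists_labelDist_eq z s₁ t₁
  have hab : a ∈ K ∨ b ∈ K := by
    have := endpoint_mem_cyclicIcc hs₁ ht₁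
    rcases hK with rfl | rfl
    exacts [this.1, this.2]
  have hqa : z q ≤ z a := by
    rcases hab with h' | h'
    · exact hmin a h'
    · rw [hz a b h.treeDist_eq_zero]
      exact hmin b h'
  have e1 := (le_abs_self _).trans (abs_sub_le_brownianDist hz s s₁)
  have e2 := (neg_le_abs _).trans (abs_sub_le_brownianDist hz t₁ t)
  linarith

/-- The mean of the cactus bounds at the roots of two branches; the labels of the roots need not be
close to each other. -/
theorem brownianDist_ge_add_of_disjoint {f z : C(unitInterval, ℝ)} (hz : LabelCompatible f z)
    {a b s a' b' s' : unitInterval} (h : IsExcursionInterval f a b)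
    (h' : IsExcursionInterval f a' b') (hs : s ∈ Set.Ioo a b) (hs' : s' ∈ Set.Ioo a' b')
    (h1 : s' ∉ Set.Ioo a b) (h2 : s ∉ Set.Ioo a' b') :
    (z s - z a) + (z s' - z a') ≤ brownianDist f z s s' := by
  have e1 := h.le_brownianDist hz hs h1
  have e2 := h'.le_brownianDist hz hs' h2
  rw [brownianDist_comm] at e2
  linarith

/-! ### Cutting along simple geodesics -/

/-- `q` lies on one of the two simple geodesics that start at `e`: on some cyclic interval
containing `e` and `q`, the labels are at least `z q`. -/
def OnSimpleGeodesic (z : C(unitInterval, ℝ)) (e q : unitInterval) : Prop :=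
  ∃ x y, e ∈ cyclicIcc x y ∧ q ∈ cyclicIcc x y ∧ ∀ u ∈ cyclicIcc x y, z q ≤ z u

/-- The points on the simple geodesics starting at `e` form an isometric copy of a subset of the
line, with the labels as coordinates. -/
theorem OnSimpleGeodesic.brownianDist_le (f : C(unitInterval, ℝ)) {z : C(unitInterval, ℝ)}
    {e q q' : unitInterval} (h : OnSimpleGeodesic z e q) (h' : OnSimpleGeodesic z e q') :
    brownianDist f z q q' ≤ |z q - z q'| := by
  obtain ⟨x, y, he, hq, hmin⟩ := h
  obtain ⟨x', y', he', hq', hmin'⟩ := h'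
  have hsub := cyclicIcc_subset_union (cyclicIcc_subset_of_mem hq he)
    (cyclicIcc_subset_of_mem hq' he')
  have hle : ∀ u ∈ cyclicIcc x y ∪ cyclicIcc x' y', min (z q) (z q') ≤ z u := by
    rintro u (hu | hu)
    · exact (min_le_left _ _).trans (hmin u hu)
    · exact (min_le_right _ _).trans (hmin' u hu)
  refine (brownianDist_le_labelDist f z q q').trans ((labelDist_le_of_forall_le z
    (c := min (z q) (z q')) ?_).trans ?_)
  · exact hsub.imp (fun h u hu => hle u (h hu)) (fun h u hu => hle u (h hu))
  · rcases le_total (z q) (z q') with h | h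
    · rw [min_eq_left h, abs_of_nonpos (by linarith)]
      linarith
    · rw [min_eq_right h, abs_of_nonneg (by linarith)]
      linarith

/-- If the times `s ≤ t` represent the same point of the tree, then a path from a time in `[s, t]`
to a time outside crosses one of the simple geodesics starting at `s` and at `t`. -/
theorem exists_crossing (f z : C(unitInterval, ℝ)) {s t : unitInterval} (hst : treeDist f s t = 0)
    {x y : unitInterval} (hx : x ∈ Set.Icc s t) (hy : y ∉ Set.Ioo s t) {ε : ℝ} (hε : 0 < ε) :
    ∃ q, (OnSimpleGeodesic z s q ∨ OnSimpleGeodesic z t q) ∧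
      brownianDist f z x q + brownianDist f z q y ≤ brownianDist f z x y + ε := by
  -- A geodesic ending at, or jumping into, the tree point of `s` crosses at `s` itself.
  have hself : OnSimpleGeodesic z s s :=
    ⟨s, s, left_mem_cyclicIcc s s, left_mem_cyclicIcc s s, by simp [cyclicIcc]⟩
  have hle : s ≤ t := hx.1.trans hx.2
  have hfst : f s = f t := (le_of_treeDist_eq_zero f hst Set.left_mem_uIcc).2
  have habove : ∀ u ∈ Set.Icc s t, f s ≤ f u := fun u hu =>
    (le_of_treeDist_eq_zero f hst (by rwa [Set.uIcc_of_le hle])).1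
  -- A time in `[s, t]` at the level of `s` represents the same point of the tree as `s`.
  have hclass : ∀ u ∈ Set.Icc s t, f u ≤ f s → treeDist f u s = 0 := fun u hu hus => by
    rw [treeDist_comm]
    exact treeDist_eq_zero_of_le f hu.1 (le_antisymm (habove u hu) hus) fun v hv =>
      habove v ⟨hv.1, hv.2.trans hu.2⟩
  by_cases hxs : f x ≤ f s
  · refine ⟨s, Or.inl hself, ?_⟩
    rw [brownianDist_congr_left f z (hclass x hx hxs), brownianDist_self,
      brownianDist_congr_left f z (hclass x hx hxs)]
    linarith
  push Not at hxs
  have hsat : ∀ u ∈ {u | u ∈ Set.Ioo s t ∧ f s < f u}, ∀ v, treeDist f u v = 0 →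
      v ∈ {u | u ∈ Set.Ioo s t ∧ f s < f u} := by
    rintro u ⟨hu, hfu⟩ v huv
    refine ⟨⟨?_, ?_⟩, hfu.trans_eq (le_of_treeDist_eq_zero f huv Set.left_mem_uIcc).2⟩
    · by_contra! h
      have := (le_of_treeDist_eq_zero f huv (Set.mem_uIcc_of_ge h hu.1.le)).1
      linarith
    · by_contra! h
      have := (le_of_treeDist_eq_zero f huv (Set.mem_uIcc_of_le hu.2.le h)).1
      linarith
  have hxC : x ∈ {u | u ∈ Set.Ioo s t ∧ f s < f u} :=
    ⟨⟨hx.1.lt_of_ne (by rintro rfl; exact lt_irrefl _ hxs),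
      hx.2.lt_of_ne (by rintro rfl; exact hxs.ne hfst)⟩, hxs⟩
  obtain ⟨s₁, hs₁, t₁, ht₁, hjump⟩ := exists_jump f z hsat hxC (fun h => hy h.1) hε
  by_cases hts : t₁ ∈ Set.Ioo s t
  · have h0 : treeDist f t₁ s = 0 :=
      hclass t₁ ⟨hts.1.le, hts.2.le⟩ (le_of_not_gt fun h => ht₁ ⟨hts, h⟩)
    refine ⟨s, Or.inl hself, ?_⟩
    rw [brownianDist_congr_left f z h0] at hjump
    have h1 := brownianDist_triangle f z x s₁ s
    have h2 := brownianDist_le_labelDist f z s₁ t₁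
    rw [brownianDist_comm f z s₁ t₁, brownianDist_congr_left f z h0,
      brownianDist_comm f z s s₁] at h2
    linarith
  obtain ⟨K, q, hK, hq, hmin, he⟩ := exists_labelDist_eq z s₁ t₁
  have hmem : s₁ ∈ K ∧ t₁ ∈ K ∧ (s ∈ K ∨ t ∈ K) := by
    have := endpoint_mem_cyclicIcc hs₁.1 hts
    rcases hK with rfl | rfl
    exacts [⟨left_mem_cyclicIcc _ _, right_mem_cyclicIcc _ _, this.1⟩,
      ⟨right_mem_cyclicIcc _ _, left_mem_cyclicIcc _ _, this.2⟩]
  have hq' : ∀ p ∈ K, brownianDist f z p q ≤ z p - z q := by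
    intro p hp
    have hsub : cyclicIcc p q ⊆ K ∨ cyclicIcc q p ⊆ K := by
      rcases hK with rfl | rfl <;> exact cyclicIcc_subset_of_mem hp hq
    have := labelDist_le_of_forall_le z (s := p) (t := q) (c := z q)
      (hsub.imp (fun h u hu => hmin u (h hu)) (fun h u hu => hmin u (h hu)))
    linarith [brownianDist_le_labelDist f z p q]
  -- The jump from `s₁` to `t₁` descends to the minimum `q` and climbs up again.
  refine ⟨q, ?_, ?_⟩
  · rcases hK with rfl | rfl
    exacts [hmem.2.2.imp (fun h => ⟨_, _, h, hq, hmin⟩) (fun h => ⟨_, _, h, hq, hmin⟩),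
      hmem.2.2.imp (fun h => ⟨_, _, h, hq, hmin⟩) (fun h => ⟨_, _, h, hq, hmin⟩)]
  · have h1 := brownianDist_triangle f z x s₁ q
    have h2 := brownianDist_triangle f z q t₁ y
    have h3 := hq' s₁ hmem.1
    have h4 := hq' t₁ hmem.2.1
    rw [brownianDist_comm] at h4
    linarith

/-! ### Ramsey's theorem and the doubling property -/

/-- The first half of Ramsey's theorem: a long list in which the colour of a pair depends only on its
first element. -/
theorem exists_prehomogeneous {α : Type*} (k L : ℕ) : ∃ M : ℕ, ∀ (S : Finset α)
    (c : α → α → Fin k), M ≤ S.card → ∃ (l : List α) (g : α → Fin k), l.length = L ∧ l.Nodup ∧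
      (∀ x ∈ l, x ∈ S) ∧ l.Pairwise fun x y => c x y = g x := by
  classical
  induction L with
  | zero =>
    refine ⟨1, fun S c hS => ?_⟩
    obtain ⟨x, -⟩ := Finset.card_pos.1 hS
    exact ⟨[], c x, by simp⟩
  | succ L ih =>
    obtain ⟨M, hM⟩ := ih
    refine ⟨k * M + 2, fun S c hS => ?_⟩
    obtain ⟨x, hx⟩ : S.Nonempty := Finset.card_pos.1 (by omega)
    have hcard : k * M < (S.erase x).card := by
      rw [Finset.card_erase_of_mem hx]
      omega
    obtain ⟨j, -, hj⟩ := Finset.exists_lt_card_fiber_of_mul_lt_card_of_maps_to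
      (s := S.erase x) (t := Finset.univ) (f := c x) (n := M) (by simp) (by simpa using hcard)
    obtain ⟨l, g, hl, hnd, hmem, hpw⟩ := hM _ c hj.le
    have hxl : x ∉ l := fun h => by simpa using hmem x h
    refine ⟨x :: l, Function.update g x j, by simp [hl], List.nodup_cons.2 ⟨hxl, hnd⟩, ?_, ?_⟩
    · intro y hy
      rcases List.mem_cons.1 hy with rfl | hy
      · exact hx
      · exact Finset.mem_of_mem_erase (Finset.mem_filter.1 (hmem y hy)).1
    · refine List.pairwise_cons.2 ⟨fun y hy => ?_, hpw.imp_of_mem fun {a b} ha _ hab => ?_⟩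
      · simpa using (Finset.mem_filter.1 (hmem y hy)).2
      · rwa [Function.update_of_ne (by rintro rfl; exact hxl ha)]

/-- Ramsey's theorem for pairs and `k` colours. -/
theorem exists_homogeneous {α : Type*} (k m : ℕ) : ∃ M : ℕ, ∀ (S : Finset α)
    (c : α → α → Fin k), (∀ x y, c x y = c y x) → M ≤ S.card →
      ∃ T ⊆ S, m ≤ T.card ∧ ∃ j, ∀ x ∈ T, ∀ y ∈ T, x ≠ y → c x y = j := by
  classical
  obtain ⟨M, hM⟩ := exists_prehomogeneous (α := α) k (k * m + 1)
  refine ⟨M, fun S c hc hS => ?_⟩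
  obtain ⟨l, g, hl, hnd, hmem, hpw⟩ := hM S c hS
  obtain ⟨j, -, hj⟩ := Finset.exists_lt_card_fiber_of_mul_lt_card_of_maps_to
    (s := l.toFinset) (t := Finset.univ) (f := g) (n := m) (by simp)
    (by simp [List.toFinset_card_of_nodup hnd, hl])
  refine ⟨_, fun x hx => hmem x (List.mem_toFinset.1 (Finset.mem_filter.1 hx).1), hj.le, j, ?_⟩
  intro x hx y hy hxy
  rw [Finset.mem_filter, List.mem_toFinset] at hx hy
  have : ∀ x ∈ l, ∀ y ∈ l, x ≠ y → c x y = g x ∨ c x y = g y := by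
    have hpw' : l.Pairwise fun x y => c x y = g x ∨ c x y = g y := hpw.imp fun h => Or.inl h
    intro x hx y hy hxy
    have : Std.Symm fun x y => c x y = g x ∨ c x y = g y :=
      ⟨fun x y h => by rw [hc y x, or_comm]; exact h⟩
    exact hpw'.forall hx hy hxy
  rcases this x hx.1 y hy.1 hxy with h | h
  · exact h.trans hx.2
  · exact h.trans hy.2

/-- There are no `N` points whose mutual distances are comparable up to the factor `4`. This is a
form of the doubling property, see `HasNoNearSimplex.card_le`. -/
def HasNoNearSimplex (X : Type*) [PseudoMetricSpace X] (N : ℕ) : Prop :=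
  ∀ (R : ℝ) (S : Finset X), 0 < R →
    (∀ x ∈ S, ∀ y ∈ S, x ≠ y → R / 4 ≤ dist x y ∧ dist x y ≤ R) → S.card < N

/-- Each of the `m` halvings of the scale costs a factor `N`. -/
theorem HasNoNearSimplex.card_le {X : Type*} [PseudoMetricSpace X] {N : ℕ}
    (h : HasNoNearSimplex X N) (m : ℕ) {σ : ℝ} (hσ : 0 < σ) : ∀ (R : ℝ) (S : Finset X),
    (∀ x ∈ S, ∀ y ∈ S, x ≠ y → σ ≤ dist x y ∧ dist x y ≤ R) → R < 2 ^ m * σ →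
      S.card ≤ N ^ m := by
  classical
  induction m with
  | zero =>
    intro R S hS hR
    rw [pow_zero, Finset.card_le_one]
    intro x hx y hy
    by_contra hxy
    have := hS x hx y hy hxy
    linarith
  | succ m ih =>
    intro R S hS hR
    by_cases hR0 : R ≤ 0
    · refine (Finset.card_le_one.2 fun x hx y hy => ?_).trans
        (Nat.one_le_pow _ _ ((Nat.zero_le _).trans_lt (h 1 ∅ one_pos (by simp))))
      by_contra hxy
      have := hS x hx y hy hxy
      linarith
    push Not at hR0
    -- A maximal `R / 4`-separated subset `T`; the balls of radius `R / 4` around it cover `S`.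
    obtain ⟨T, hT, hmax⟩ := Finset.exists_max_image
      (S.powerset.filter fun T => ∀ x ∈ T, ∀ y ∈ T, x ≠ y → R / 4 ≤ dist x y) Finset.card
      ⟨∅, by simp⟩
    rw [Finset.mem_filter, Finset.mem_powerset] at hT
    have hTcard : T.card < N := h R T hR0 fun x hx y hy hxy =>
      ⟨hT.2 x hx y hy hxy, (hS x (hT.1 hx) y (hT.1 hy) hxy).2⟩
    have hcover : S ⊆ T.biUnion fun p => S.filter fun x => dist p x ≤ R / 4 := by
      intro x hx
      rw [Finset.mem_biUnion]
      by_contra! hcon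
      have hfar : ∀ p ∈ T, R / 4 < dist p x := fun p hp => by
        by_contra! hle
        exact hcon p hp (Finset.mem_filter.2 ⟨hx, hle⟩)
      have hxT : x ∉ T := fun hxT => by
        have := hfar x hxT
        rw [dist_self] at this
        linarith
      have := hmax (insert x T) (by
        rw [Finset.mem_filter, Finset.mem_powerset]
        refine ⟨Finset.insert_subset hx hT.1, fun a ha b hb hab => ?_⟩
        rcases Finset.mem_insert.1 ha with rfl | ha' <;>
          rcases Finset.mem_insert.1 hb with rfl | hb'
        · exact absurd rfl hab
        · rw [dist_comm]
          exact (hfar b hb').le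
        · exact (hfar a ha').le
        · exact hT.2 a ha' b hb' hab)
      rw [Finset.card_insert_of_notMem hxT] at this
      omega
    calc S.card ≤ (T.biUnion fun p => S.filter fun x => dist p x ≤ R / 4).card :=
          Finset.card_le_card hcover
      _ ≤ T.card * N ^ m := Finset.card_biUnion_le_card_mul _ _ _ fun p hp => by
          refine ih (R / 2) _ (fun x hx y hy hxy => ?_) (by rw [pow_succ] at hR; linarith)
          rw [Finset.mem_filter] at hx hy
          refine ⟨(hS x hx.1 y hy.1 hxy).1, ?_⟩
          have := dist_triangle_left x y p
          linarith [hx.2, hy.2]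
      _ ≤ N ^ (m + 1) := by
          rw [pow_succ, mul_comm]
          exact Nat.mul_le_mul_left _ hTcard.le

/-! ### Extracting stars from near-simplices -/

theorem IsExcursion.nonneg {f : C(unitInterval, ℝ)} (hf : IsExcursion f) (t : unitInterval) :
    0 ≤ f t := by
  rcases (unitInterval.nonneg' (t := t)).eq_or_lt with rfl | h0
  · exact hf.1.ge
  rcases (unitInterval.le_one' (t := t)).eq_or_lt with rfl | h1
  · exact hf.2.1.ge
  · exact (hf.2.2 t h0 h1).le

theorem exists_initial_subset {α : Type*} [LinearOrder α] (W : Finset α) {n : ℕ}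
    (hn : n ≤ W.card) : ∃ A ⊆ W, A.card = n ∧ ∀ x ∈ A, ∀ y ∈ W \ A, x < y := by
  induction n with
  | zero => exact ⟨∅, by simp, by simp, by simp⟩
  | succ n ih =>
    obtain ⟨A, hA, hcard, hlt⟩ := ih (by omega)
    have hne : (W \ A).Nonempty := by
      rw [← Finset.card_pos, Finset.card_sdiff_of_subset hA]
      omega
    have hmem := Finset.min'_mem _ hne
    have hmem' := Finset.mem_sdiff.1 hmem
    refine ⟨insert ((W \ A).min' hne) A, Finset.insert_subset hmem'.1 hA, ?_, ?_⟩
    · rw [Finset.card_insert_of_notMem hmem'.2, hcard]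
    · intro x hx y hy
      rw [Finset.mem_sdiff, Finset.mem_insert, not_or] at hy
      have hy' : y ∈ W \ A := Finset.mem_sdiff.2 ⟨hy.1, hy.2.2⟩
      rcases Finset.mem_insert.1 hx with rfl | hx
      · exact lt_of_le_of_ne (Finset.min'_le _ _ hy') (Ne.symm hy.2.1)
      · exact hlt x hx y hy'

/-- Any finite set of times is cut into two large parts by two times representing the same point of
the tree. -/
theorem exists_cut {f : C(unitInterval, ℝ)} (hf : IsExcursion f) (W : Finset unitInterval) {k : ℕ}
    (hk : 0 < k) (hW : 4 * k ≤ W.card) :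
    ∃ s t, treeDist f s t = 0 ∧ ∃ U ⊆ W, ∃ V ⊆ W, k ≤ U.card ∧ k ≤ V.card ∧
      (∀ x ∈ U, x ∈ Set.Icc s t) ∧ (∀ y ∈ V, y ∉ Set.Ioo s t) ∧ ∀ x ∈ U, ∀ y ∈ V, x ≠ y := by
  obtain ⟨A, hA, hAcard, hAlt⟩ := exists_initial_subset W (n := k) (by omega)
  obtain ⟨B, hB, hBcard, hBlt⟩ := exists_initial_subset (W \ A) (n := 2 * k) (by
    rw [Finset.card_sdiff_of_subset hA]
    omega)
  have hCcard : k ≤ ((W \ A) \ B).card := by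
    rw [Finset.card_sdiff_of_subset hB, Finset.card_sdiff_of_subset hA]
    omega
  have hBne : B.Nonempty := Finset.card_pos.1 (by omega)
  -- Cut at the minimum of `f` over the middle half `B`, and at the times before and after `B` at
  -- which `f` takes the same value: these three times represent one point of the tree.
  set p := B.min' hBne
  set r := B.max' hBne
  have hp : p ∈ B := Finset.min'_mem _ _
  have hr : r ∈ B := Finset.max'_mem _ _
  have hpr : p ≤ r := Finset.min'_le _ _ hr
  obtain ⟨t, ht, hmin⟩ := isCompact_Icc.exists_isMinOn (Set.nonempty_Icc.2 hpr)
    f.continuous.continuousOn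
  have hmin' : ∀ u ∈ Set.Icc p r, f t ≤ f u := fun u hu => hmin hu
  obtain ⟨a, hap, ha, ha'⟩ := exists_last_hitting f (hf.1.trans_le (hf.nonneg t))
    (hmin' p ⟨le_rfl, hpr⟩)
  obtain ⟨b, hbr, hb, hb'⟩ := exists_first_hitting f (hf.2.1.trans_le (hf.nonneg t))
    (hmin' r ⟨hpr, le_rfl⟩)
  have habove : ∀ u ∈ Set.Icc a b, f t ≤ f u := by
    intro u hu
    rcases le_total u p with h | h
    · rcases hu.1.eq_or_lt with rfl | h'
      exacts [ha.ge, (ha' u h' h).le]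
    rcases le_total r u with h' | h'
    · rcases hu.2.eq_or_lt with rfl | h''
      exacts [hb.ge, (hb' u h' h'').le]
    · exact hmin' u ⟨h, h'⟩
  have hat : a ≤ t := hap.trans ht.1
  have htb : t ≤ b := ht.2.trans hbr
  have hBmem : ∀ x ∈ B, a ≤ x ∧ x ≤ b := fun x hx =>
    ⟨hap.trans (Finset.min'_le _ _ hx), (Finset.le_max' _ _ hx).trans hbr⟩
  have hsum := Finset.card_filter_add_card_filter_not (s := B) fun x => x ≤ t
  by_cases hcase : k ≤ (B.filter fun x => x ≤ t).card
  · refine ⟨a, t, treeDist_eq_zero_of_le f hat ha fun u hu => ?_, B.filter fun x => x ≤ t, ?_,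
      (W \ A) \ B, ?_, hcase, hCcard, ?_, ?_, ?_⟩
    · rw [ha]
      exact habove u ⟨hu.1, hu.2.trans htb⟩
    · exact (Finset.filter_subset _ _).trans (hB.trans Finset.sdiff_subset)
    · exact Finset.sdiff_subset.trans Finset.sdiff_subset
    · intro x hx
      rw [Finset.mem_filter] at hx
      exact ⟨(hBmem x hx.1).1, hx.2⟩
    · intro y hy hy'
      exact absurd (hy'.2.trans_le ht.2) (hBlt r hr y hy).not_gt
    · intro x hx y hy
      exact (hBlt x (Finset.mem_filter.1 hx).1 y hy).ne
  · refine ⟨t, b, treeDist_eq_zero_of_le f htb hb.symm fun u hu => ?_,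
      B.filter fun x => ¬ x ≤ t, ?_, A, hA, by omega, hAcard.ge, ?_, ?_, ?_⟩
    · exact habove u ⟨hat.trans hu.1, hu.2⟩
    · exact (Finset.filter_subset _ _).trans (hB.trans Finset.sdiff_subset)
    · intro x hx
      rw [Finset.mem_filter] at hx
      exact ⟨(not_le.1 hx.2).le, (hBmem x hx.1).2⟩
    · intro y hy hy'
      exact absurd (ht.1.trans_lt hy'.1) (hAlt y hy p (hB hp)).not_gt
    · intro x hx y hy
      exact (hAlt y hy x (hB (Finset.mem_filter.1 hx).1)).ne'

theorem abs_sub_lt_of_floor_eq {u v w : ℝ} (hw : 0 < w) (hu : 0 ≤ u) (hv : 0 ≤ v)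
    (h : ⌊u / w⌋₊ = ⌊v / w⌋₊) : |u - v| < w := by
  have h1 := Nat.floor_le (div_nonneg hu hw.le)
  have h2 := Nat.lt_floor_add_one (u / w)
  have h3 := Nat.floor_le (div_nonneg hv hw.le)
  have h4 := Nat.lt_floor_add_one (v / w)
  rw [h] at h1 h2
  rw [le_div_iff₀ hw] at h1 h3
  rw [div_lt_iff₀ hw] at h2 h4
  rw [abs_lt]
  constructor <;> linarith

/-- Many almost equidistant points on one side of a cut, and five on the other, yield a hub `q` that
is almost equidistant from many points, at a distance strictly below `a`. The number `K` bounds the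
number of bins of width `w` for labels and distances. -/
theorem exists_hub {f z : C(unitInterval, ℝ)} (hz : LabelCompatible f z) {a w : ℝ} (hw : 0 < w)
    (haw : 400 * w ≤ a) {K n : ℕ} (hK : 8 * a ≤ K * w) {s t : unitInterval}
    (hst : treeDist f s t = 0) {U V : Finset unitInterval} (hV : V.card = 5)
    (hU : (2 * (K * K)) ^ 5 * (n + 2) < U.card) (hUI : ∀ x ∈ U, x ∈ Set.Icc s t)
    (hVI : ∀ y ∈ V, y ∉ Set.Ioo s t)
    (hD : ∀ x ∈ U ∪ V, ∀ y ∈ U ∪ V, x ≠ y →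
      a ≤ brownianDist f z x y ∧ brownianDist f z x y ≤ a + w)
    (hUV : ∀ x ∈ U, ∀ y ∈ V, x ≠ y) :
    ∃ (q : unitInterval) (T : Finset unitInterval) (ρ : ℝ), T ⊆ U ∧ n ≤ T.card ∧ 100 * w ≤ ρ ∧
      ρ ≤ 9 / 10 * a ∧ ∀ x ∈ T, ρ ≤ brownianDist f z q x ∧
        brownianDist f z q x ≤ ρ + 4 * w := by
  classical
  have hQ : ∀ x y, ∃ q, x ∈ U → y ∈ V → (OnSimpleGeodesic z s q ∨ OnSimpleGeodesic z t q) ∧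
      brownianDist f z x q + brownianDist f z q y ≤ a + 2 * w := by
    intro x y
    by_cases h : x ∈ U ∧ y ∈ V
    · obtain ⟨q, hq, hle⟩ := exists_crossing f z hst (hUI x h.1) (hVI y h.2) hw
      have := (hD x (Finset.mem_union_left _ h.1) y (Finset.mem_union_right _ h.2)
        (hUV x h.1 y h.2)).2
      exact ⟨q, fun _ _ => ⟨hq, by linarith⟩⟩
    · exact ⟨x, fun h1 h2 => absurd ⟨h1, h2⟩ h⟩
  choose Q hQ using hQ
  have hnonneg : ∀ x y, 0 ≤ brownianDist f z x y := fun x y =>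
    le_brownianDist f z fun n u _ _ => Finset.sum_nonneg fun i _ => treeLabelDist_nonneg f z _ _
  have hUV' : ∀ x ∈ U, ∀ y ∈ V, brownianDist f z x (Q x y) ≤ a + 2 * w := fun x hx y hy => by
    have := (hQ x y hx hy).2
    linarith [hnonneg (Q x y) y]
  obtain ⟨x₀, hx₀⟩ : U.Nonempty := Finset.card_pos.1 ((Nat.zero_le _).trans_lt hU)
  have hrange : ∀ x ∈ U, ∀ y ∈ V, 0 ≤ z (Q x y) - z x₀ + 4 * a ∧
      z (Q x y) - z x₀ + 4 * a < 8 * a := fun x hx y hy => by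
    have h1 := abs_le.1 ((abs_sub_le_brownianDist hz x (Q x y)).trans (hUV' x hx y hy))
    have h2 : |z x - z x₀| ≤ a + w := by
      by_cases h : x = x₀
      · rw [h, sub_self, abs_zero]
        linarith
      · exact (abs_sub_le_brownianDist hz x x₀).trans (hD x (Finset.mem_union_left _ hx) x₀
          (Finset.mem_union_left _ hx₀) h).2
    have h2 := abs_le.1 h2
    constructor <;> linarith
  -- The colour of `x` records, up to `w`, where the geodesics from `x` to `V` cross the cut.
  let col : unitInterval → V → Bool × ℕ × ℕ := fun x y =>
    (decide (OnSimpleGeodesic z s (Q x y)), ⌊(z (Q x y) - z x₀ + 4 * a) / w⌋₊,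
      ⌊brownianDist f z x (Q x y) / w⌋₊)
  have hfloor : ∀ u : ℝ, u < 8 * a → ⌊u / w⌋₊ ∈ Finset.range K := fun u hu => by
    rw [Finset.mem_range]
    have hKpos : K ≠ 0 := by
      rintro rfl
      norm_num at hK
      linarith
    rw [Nat.floor_lt' hKpos, div_lt_iff₀ hw]
    linarith
  obtain ⟨c, -, hc⟩ := Finset.exists_lt_card_fiber_of_mul_lt_card_of_maps_to
    (s := U) (t := Fintype.piFinset fun _ : V =>
      (Finset.univ : Finset Bool) ×ˢ Finset.range K ×ˢ Finset.range K) (f := col) (n := n + 2)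
    (fun x hx => by
      rw [Fintype.mem_piFinset]
      intro y
      rw [Finset.mem_product, Finset.mem_product]
      refine ⟨Finset.mem_univ _, hfloor _ (hrange x hx y y.2).2, hfloor _ ?_⟩
      linarith [hUV' x hx y y.2])
    (by simpa [hV] using hU)
  set T := U.filter fun x => col x = c
  have hTU : ∀ x ∈ T, x ∈ U := fun x hx => (Finset.mem_filter.1 hx).1
  obtain ⟨x₁, hx₁, x₂, hx₂, hx₁₂⟩ := Finset.one_lt_card.1 (show 1 < T.card by omega)
  have hside : ∀ x ∈ U, ∀ y ∈ V, ∀ x' ∈ U, ∀ y' ∈ V,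
      decide (OnSimpleGeodesic z s (Q x y)) = decide (OnSimpleGeodesic z s (Q x' y')) →
      brownianDist f z (Q x y) (Q x' y') ≤ |z (Q x y) - z (Q x' y')| := by
    intro x hx y hy x' hx' y' hy' h
    rw [decide_eq_decide] at h
    by_cases hs : OnSimpleGeodesic z s (Q x y)
    · exact hs.brownianDist_le f (h.1 hs)
    · exact ((hQ x y hx hy).1.resolve_left hs).brownianDist_le f
        ((hQ x' y' hx' hy').1.resolve_left fun h' => hs (h.2 h'))
  have hclose : ∀ x ∈ T, ∀ y ∈ V, |brownianDist f z (Q x₁ y) x - brownianDist f z x₁ (Q x₁ y)|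
      ≤ 2 * w := by
    intro x hx y hy
    have hcol : col x ⟨y, hy⟩ = col x₁ ⟨y, hy⟩ := by
      rw [(Finset.mem_filter.1 hx).2, (Finset.mem_filter.1 hx₁).2]
    simp only [col, Prod.mk.injEq] at hcol
    obtain ⟨h1, h2, h3⟩ := hcol
    have e1 := hside x (hTU x hx) y hy x₁ (hTU x₁ hx₁) y hy h1
    have e2 := abs_sub_lt_of_floor_eq hw (hrange x (hTU x hx) y hy).1
      (hrange x₁ (hTU x₁ hx₁) y hy).1 h2
    rw [add_sub_add_right_eq_sub, sub_sub_sub_cancel_right] at e2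
    have e3 := abs_lt.1 (abs_sub_lt_of_floor_eq hw (hnonneg _ _) (hnonneg _ _) h3)
    have e4 := brownianDist_triangle f z x (Q x y) (Q x₁ y)
    have e5 := brownianDist_triangle f z x (Q x₁ y) (Q x y)
    rw [brownianDist_comm f z (Q x₁ y) (Q x y)] at e5
    rw [brownianDist_comm f z (Q x₁ y) x, abs_le]
    constructor <;> linarith
  have hlarge : ∀ y ∈ V, a / 2 - 2 * w ≤ brownianDist f z x₁ (Q x₁ y) := by
    intro y hy
    have e1 := (hD x₁ (Finset.mem_union_left _ (hTU _ hx₁)) x₂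
      (Finset.mem_union_left _ (hTU _ hx₂)) hx₁₂).1
    have e2 := brownianDist_triangle f z x₁ (Q x₁ y) x₂
    have e3 := abs_le.1 (hclose x₂ hx₂ y hy)
    linarith
  -- If every crossing point were close to the end of its geodesic, three points of `V` would be
  -- almost equidistant points of a line.
  obtain ⟨y, hy, hsmall⟩ : ∃ y ∈ V, brownianDist f z x₁ (Q x₁ y) ≤ 9 / 10 * a := by
    by_contra! hcon
    have hnear : ∀ y ∈ V, brownianDist f z (Q x₁ y) y ≤ a / 10 + 2 * w := fun y hy => by
      have := (hQ x₁ y (hTU x₁ hx₁) hy).2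
      linarith [hcon y hy]
    obtain ⟨e, -, he⟩ := Finset.exists_lt_card_fiber_of_mul_lt_card_of_maps_to
      (s := V) (t := Finset.univ) (f := fun y => decide (OnSimpleGeodesic z s (Q x₁ y))) (n := 2)
      (fun _ _ => Finset.mem_univ _) (by simp [hV])
    obtain ⟨y₁, h1, y₂, h2, y₃, h3, h12, h13, h23⟩ := Finset.two_lt_card.1 he
    rw [Finset.mem_filter] at h1 h2 h3
    have hline : ∀ y y', y ∈ V → y' ∈ V → y ≠ y' →
        decide (OnSimpleGeodesic z s (Q x₁ y)) = decide (OnSimpleGeodesic z s (Q x₁ y')) →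
        7 / 10 * a ≤ |z (Q x₁ y) - z (Q x₁ y')| ∧ |z (Q x₁ y) - z (Q x₁ y')| ≤ 13 / 10 * a := by
      intro y y' hy hy' hne he
      have e1 := hside x₁ (hTU x₁ hx₁) y hy x₁ (hTU x₁ hx₁) y' hy' he
      have e2 := abs_sub_le_brownianDist hz (Q x₁ y) (Q x₁ y')
      have e3 := hD y (Finset.mem_union_right _ hy) y' (Finset.mem_union_right _ hy') hne
      have e4 := brownianDist_triangle f z y (Q x₁ y) y'
      have e5 := brownianDist_triangle f z (Q x₁ y) (Q x₁ y') y'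
      have e6 := brownianDist_triangle f z (Q x₁ y) y (Q x₁ y')
      have e7 := brownianDist_triangle f z y y' (Q x₁ y')
      rw [brownianDist_comm f z y (Q x₁ y)] at e4
      rw [brownianDist_comm f z y' (Q x₁ y')] at e7
      have e8 := hnear y hy
      have e9 := hnear y' hy'
      constructor <;> linarith
    have e12 := hline y₁ y₂ h1.1 h2.1 h12 (h1.2.trans h2.2.symm)
    have e13 := hline y₁ y₃ h1.1 h3.1 h13 (h1.2.trans h3.2.symm)
    have e23 := hline y₂ y₃ h2.1 h3.1 h23 (h2.2.trans h3.2.symm)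
    have habs : ∀ u v : ℝ, |u - v| = u - v ∨ |u - v| = v - u := fun u v => by
      rcases abs_choice (u - v) with h | h
      · exact Or.inl h
      · exact Or.inr (by rw [h]; ring)
    rcases habs (z (Q x₁ y₁)) (z (Q x₁ y₂)) with h | h <;> rw [h] at e12 <;>
      rcases habs (z (Q x₁ y₁)) (z (Q x₁ y₃)) with h | h <;> rw [h] at e13 <;>
        rcases habs (z (Q x₁ y₂)) (z (Q x₁ y₃)) with h | h <;> rw [h] at e23 <;> linarith
  refine ⟨Q x₁ y, T, brownianDist f z x₁ (Q x₁ y) - 2 * w, fun x hx => hTU x hx, by omega, ?_, ?_,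
    fun x hx => ?_⟩
  · linarith [hlarge y hy]
  · linarith
  · have := abs_le.1 (hclose x hx y hy)
    constructor <;> linarith

/-- The canonical projection `[0,1] → Φ(f)`. -/
noncomputable def brownianProj (f z : C(unitInterval, ℝ)) (s : unitInterval) : BrownianMap f z :=
  SeparationQuotient.mk (X := LabelledInterval f z) s

theorem dist_brownianProj (f z : C(unitInterval, ℝ)) (s t : unitInterval) :
    dist (brownianProj f z s) (brownianProj f z t) = brownianDist f z s t :=
  SeparationQuotient.dist_mk (α := LabelledInterval f z) s t

/-- A space with near-simplices of all sizes is starry, with `A = 11/10` and `η = 1/25`. -/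
theorem starry_of_nearSimplices {f z : C(unitInterval, ℝ)} (hf : IsExcursion f)
    (hz : LabelCompatible f z) (h : ∀ N, ¬ HasNoNearSimplex (LabelledInterval f z) N) :
    Starry (BrownianMap f z) := by
  classical
  refine ⟨11 / 10, 1 / 25, by norm_num, by norm_num, by norm_num, fun n => ?_⟩
  -- `K` is kept opaque, to prevent the numeral `(2 * 16000 ^ 2) ^ 5` from being unfolded.
  obtain ⟨K, hK⟩ : ∃ K : ℕ, (K : ℝ) = 16000 := ⟨16000, by norm_num⟩
  -- Distances are sorted into bins of width `w = R / 2000`, so that `K * w = 8 * R`.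
  set k := (2 * (K * K)) ^ 5 * (n + 2) + 5 with hk
  obtain ⟨M, hM⟩ := exists_homogeneous (α := unitInterval) 2001 (4 * k)
  have hsimplex := h M
  simp only [HasNoNearSimplex, not_forall, not_lt] at hsimplex
  obtain ⟨R, S, hR, hS, hcard⟩ := hsimplex
  replace hS : ∀ x ∈ S, ∀ y ∈ S, x ≠ y →
    R / 4 ≤ brownianDist f z x y ∧ brownianDist f z x y ≤ R := hS
  set w := R / 2000 with hw
  have hwpos : 0 < w := by positivity
  obtain ⟨W, hWS, hWcard, j, hj⟩ := hM S
    (fun x y => ⟨min ⌊brownianDist f z x y / w⌋₊ 2000, by omega⟩)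
    (fun x y => by simp only [brownianDist_comm f z x y]) hcard
  have hD : ∀ x ∈ W, ∀ y ∈ W, x ≠ y →
      (j : ℕ) * w ≤ brownianDist f z x y ∧ brownianDist f z x y ≤ (j : ℕ) * w + w ∧
        499 ≤ (j : ℕ) := by
    intro x hx y hy hxy
    have hxyS := hS x (hWS hx) y (hWS hy) hxy
    have hnn : 0 ≤ brownianDist f z x y / w := div_nonneg (by linarith) hwpos.le
    have hfloor : ⌊brownianDist f z x y / w⌋₊ ≤ 2000 := by
      rw [← Nat.lt_add_one_iff, Nat.floor_lt hnn, div_lt_iff₀ hwpos]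
      push_cast
      linarith
    have hje : ⌊brownianDist f z x y / w⌋₊ = j := by
      rw [← hj x hx y hy hxy, Fin.val_mk, min_eq_left hfloor]
    have h1 := Nat.floor_le hnn
    have h2 := Nat.lt_floor_add_one (brownianDist f z x y / w)
    rw [hje, le_div_iff₀ hwpos] at h1
    rw [hje, div_lt_iff₀ hwpos] at h2
    refine ⟨h1, by linarith, ?_⟩
    rw [← hje, Nat.le_floor_iff hnn, le_div_iff₀ hwpos]
    push_cast
    linarith
  obtain ⟨s, t, hst, U, hU, V', hV', hUk, hVk, hUI, hVI, hUV⟩ := exists_cut hf W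
    (k := k) (by omega) hWcard
  obtain ⟨V, hVV', hV⟩ := Finset.exists_subset_card_eq (show 5 ≤ V'.card by omega)
  have hVW := hVV'.trans hV'
  have hUVW : U ∪ V ⊆ W := Finset.union_subset hU hVW
  obtain ⟨y₁, hy₁, y₂, hy₂, hy₁₂⟩ := Finset.one_lt_card.1 (show 1 < V.card by omega)
  have hj499 : (499 : ℝ) ≤ (j : ℕ) := by
    exact_mod_cast (hD y₁ (hVW hy₁) y₂ (hVW hy₂) hy₁₂).2.2
  have hj2000 : ((j : ℕ) : ℝ) ≤ 2000 := by
    have : (j : ℕ) ≤ 2000 := by omega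
    exact_mod_cast this
  obtain ⟨q, T, ρ, hTU, hTn, hρ, hρa, hT⟩ := exists_hub hz (a := (j : ℕ) * w) hwpos
    (by nlinarith) (K := K) (n := n) (by rw [hK]; nlinarith) hst hV (by omega) hUI
    (fun y hy => hVI y (hVV' hy))
    (fun x hx y hy hxy => ⟨(hD x (hUVW hx) y (hUVW hy) hxy).1, (hD x (hUVW hx) y (hUVW hy) hxy).2.1⟩)
    (fun x hx y hy => hUV x hx y (hVV' hy))
  set a := ((j : ℕ) : ℝ) * w
  have hρpos : 0 < ρ := by linarith
  have hA : 11 / 10 ≤ (a + w) / ρ := by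
    rw [le_div_iff₀ hρpos]
    linarith
  refine ⟨(a + w) / ρ, hA, by linarith, by norm_num, by norm_num, by linarith, ρ, hρpos,
    brownianProj f z q, ?_⟩
  obtain ⟨T', hT'T, hT'⟩ := Finset.exists_subset_card_eq hTn
  have hmem : ∀ i, ((T'.equivFinOfCardEq hT').symm i : unitInterval) ∈ T := fun i =>
    hT'T ((T'.equivFinOfCardEq hT').symm i).2
  refine ⟨fun i => brownianProj f z ((T'.equivFinOfCardEq hT').symm i), fun i j hij => ?_, fun i => ?_⟩
  · rw [dist_brownianProj]
    have hne : ((T'.equivFinOfCardEq hT').symm i : unitInterval) ≠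
        ((T'.equivFinOfCardEq hT').symm j : unitInterval) := fun h => by simp [hij] at h
    obtain ⟨h1, h2, -⟩ := hD _ (hU (hTU (hmem i))) _ (hU (hTU (hmem j))) hne
    constructor
    · refine le_trans ?_ h1
      rw [sub_mul, div_mul_cancel₀ _ hρpos.ne']
      linarith
    · rw [div_mul_cancel₀ _ hρpos.ne']
      exact h2
  · rw [dist_brownianProj]
    obtain ⟨h1, h2⟩ := hT _ (hmem i)
    refine ⟨h1, h2.trans ?_⟩
    linarith

/-! ### Increments of the Gaussian labels -/

section Gaussian

variable {f : C(unitInterval, ℝ)} {Ω : Type*} [MeasurableSpace Ω] {P : Measure Ω}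
  {Z : unitInterval → Ω → ℝ}

theorem IsTreeLabel.isGaussianProcess_sub (hZ : IsTreeLabel f Z P) :
    IsGaussianProcess (fun (p : unitInterval × unitInterval) ω => Z p.1 ω - Z p.2 ω) P := by
  classical
  refine hZ.gaussian.of_isGaussianProcess fun p => ⟨{p.1, p.2},
    ContinuousLinearMap.proj (R := ℝ) (φ := fun _ => ℝ) ⟨p.1, by simp⟩ -
      ContinuousLinearMap.proj (R := ℝ) (φ := fun _ => ℝ) ⟨p.2, by simp⟩, fun ω => ?_⟩
  simp

theorem IsTreeLabel.integrable_mul (hZ : IsTreeLabel f Z P) (u v : unitInterval) :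
    Integrable (fun ω => Z u ω * Z v ω) P :=
  (hZ.gaussian.hasGaussianLaw_eval u).memLp_two.integrable_mul
    (hZ.gaussian.hasGaussianLaw_eval v).memLp_two

theorem IsTreeLabel.integral_sub_mul_sub (hZ : IsTreeLabel f Z P) (u v u' v' : unitInterval) :
    ∫ ω, (Z u ω - Z v ω) * (Z u' ω - Z v' ω) ∂P =
      minBetween f u u' - minBetween f u v' - (minBetween f v u' - minBetween f v v') := by
  have h := hZ.integrable_mul
  have e : ∀ ω, (Z u ω - Z v ω) * (Z u' ω - Z v' ω) =
      Z u ω * Z u' ω - Z u ω * Z v' ω - (Z v ω * Z u' ω - Z v ω * Z v' ω) := fun ω => by ring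
  simp_rw [e]
  refine (integral_sub ((h u u').sub (h u v')) ((h v u').sub (h v v'))).trans
    ((congrArg₂ (· - ·) (integral_sub (h u u') (h u v'))
      (integral_sub (h v u') (h v v'))).trans ?_)
  simp only [hZ.covariance]

theorem IsTreeLabel.integral_sub (hZ : IsTreeLabel f Z P) (u v : unitInterval) :
    ∫ ω, (Z u ω - Z v ω) ∂P = 0 := by
  rw [MeasureTheory.integral_sub (hZ.gaussian.hasGaussianLaw_eval u).integrable
    (hZ.gaussian.hasGaussianLaw_eval v).integrable, hZ.centered, hZ.centered, sub_zero]

theorem IsTreeLabel.aemeasurable_sub (hZ : IsTreeLabel f Z P) (u v : unitInterval) :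
    AEMeasurable (fun ω => Z u ω - Z v ω) P :=
  (hZ.gaussian.aemeasurable u).sub (hZ.gaussian.aemeasurable v)

theorem IsTreeLabel.integral_sub_sq (hZ : IsTreeLabel f Z P) (u v : unitInterval) :
    ∫ ω, (Z u ω - Z v ω) ^ 2 ∂P = treeDist f u v := by
  simp_rw [pow_two]
  rw [hZ.integral_sub_mul_sub, minBetween_self, minBetween_self, minBetween_comm f v u, treeDist]
  ring

theorem IsTreeLabel.map_sub (hZ : IsTreeLabel f Z P) (u v : unitInterval) :
    P.map (fun ω => Z u ω - Z v ω) = gaussianReal 0 (treeDist f u v).toNNReal := by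
  rw [(hZ.isGaussianProcess_sub.hasGaussianLaw_eval (u, v)).map_eq_gaussianReal,
    hZ.integral_sub, variance_of_integral_eq_zero (hZ.aemeasurable_sub u v) (hZ.integral_sub u v),
    hZ.integral_sub_sq]

theorem IsTreeLabel.ae_eq_of_treeDist_eq_zero (hZ : IsTreeLabel f Z P) {u v : unitInterval}
    (h : treeDist f u v = 0) : ∀ᵐ ω ∂P, Z u ω = Z v ω := by
  have hint : Integrable (fun ω => (Z u ω - Z v ω) ^ 2) P :=
    (hZ.isGaussianProcess_sub.hasGaussianLaw_eval (u, v)).memLp_two.integrable_sq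
  have h0 := hZ.integral_sub_sq u v
  rw [h, integral_eq_zero_iff_of_nonneg (fun ω => sq_nonneg _) hint] at h0
  filter_upwards [h0] with ω hω
  exact sub_eq_zero.1 (pow_eq_zero_iff two_ne_zero |>.1 hω)

/-- Almost surely, the labels factor through the tree, simultaneously at all times: it suffices to
check a countable dense set of pairs at tree distance zero. -/
theorem IsTreeLabel.ae_labelCompatible (hZ : IsTreeLabel f Z P) :
    ∀ᵐ ω ∂P, ∀ hc : Continuous fun t => Z t ω, LabelCompatible f ⟨fun t => Z t ω, hc⟩ := by
  set R : Set (unitInterval × unitInterval) := {p | treeDist f p.1 p.2 = 0}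
  obtain ⟨D, hDc, hD⟩ := TopologicalSpace.exists_countable_dense R
  have : ∀ᵐ ω ∂P, ∀ p ∈ D, Z p.1.1 ω = Z p.1.2 ω :=
    (ae_ball_iff hDc).2 fun p _ => hZ.ae_eq_of_treeDist_eq_zero p.2
  filter_upwards [this] with ω hω hc s t hst
  have hext : (fun p : R => Z p.1.1 ω) = fun p : R => Z p.1.2 ω :=
    Continuous.ext_on hD (hc.comp (continuous_fst.comp continuous_subtype_val))
      (hc.comp (continuous_snd.comp continuous_subtype_val)) hω
  exact congrFun hext ⟨(s, t), hst⟩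

/-- An exponential tail bound, from the Gaussian moment generating function at `σ⁻¹`; the Gaussian
rate is not needed. -/
theorem IsTreeLabel.measure_le_sub (hZ : IsTreeLabel f Z P) [IsProbabilityMeasure P]
    {u v : unitInterval} {σ : ℝ} (hσ : 0 < σ) (h : treeDist f u v ≤ σ ^ 2) (t : ℝ) :
    P {ω | t * σ ≤ Z u ω - Z v ω} ≤ ENNReal.ofReal (2 * Real.exp (-t)) := by
  have hmap := hZ.map_sub u v
  have hint : Integrable (fun ω => Real.exp (σ⁻¹ * (Z u ω - Z v ω))) P := by
    have := integrable_exp_mul_gaussianReal (μ := 0) (v := (treeDist f u v).toNNReal) σ⁻¹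
    rw [← hmap] at this
    exact this.comp_aemeasurable (hZ.aemeasurable_sub u v)
  have h1 := measure_ge_le_exp_mul_mgf (μ := P) (X := fun ω => Z u ω - Z v ω) (t * σ)
    (inv_nonneg.2 hσ.le) hint
  rw [mgf_gaussianReal hmap, ← Real.exp_add, Real.coe_toNNReal _ (treeDist_nonneg f u v)] at h1
  rw [← ofReal_measureReal]
  refine ENNReal.ofReal_le_ofReal (h1.trans ?_)
  have h2 : -σ⁻¹ * (t * σ) + (0 * σ⁻¹ + treeDist f u v * σ⁻¹ ^ 2 / 2) ≤ 1 / 2 + -t := by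
    have : treeDist f u v * σ⁻¹ ^ 2 ≤ 1 := by
      rw [inv_pow, ← div_eq_mul_inv, div_le_one (by positivity)]
      exact h
    have e : -σ⁻¹ * (t * σ) = -t := by field_simp
    rw [e]
    linarith
  refine (Real.exp_le_exp.2 h2).trans ?_
  rw [Real.exp_add]
  gcongr
  have h3 : Real.exp (1 / 2) ^ 2 ≤ 2 ^ 2 := by
    rw [← Real.exp_nat_mul]
    norm_num
    linarith [Real.exp_one_lt_d9]
  exact le_of_sq_le_sq h3 (by norm_num)

theorem IsTreeLabel.measure_le_abs_sub (hZ : IsTreeLabel f Z P) [IsProbabilityMeasure P]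
    {u v : unitInterval} {σ : ℝ} (hσ : 0 < σ) (h : treeDist f u v ≤ σ ^ 2) (t : ℝ) :
    P {ω | t * σ ≤ |Z u ω - Z v ω|} ≤ ENNReal.ofReal (4 * Real.exp (-t)) := by
  have hsub : {ω | t * σ ≤ |Z u ω - Z v ω|} ⊆
      {ω | t * σ ≤ Z u ω - Z v ω} ∪ {ω | t * σ ≤ Z v ω - Z u ω} := by
    intro ω hω
    rcases abs_choice (Z u ω - Z v ω) with h | h
    · exact Or.inl (h ▸ hω : t * σ ≤ _)
    · right
      change t * σ ≤ _ at hω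
      rw [h, neg_sub] at hω
      exact hω
  refine (measure_mono hsub).trans ((measure_union_le _ _).trans ?_)
  have h' : treeDist f v u ≤ σ ^ 2 := by rwa [treeDist_comm]
  refine (add_le_add (hZ.measure_le_sub hσ h t) (hZ.measure_le_sub hσ h' t)).trans ?_
  rw [← ENNReal.ofReal_add (by positivity) (by positivity)]
  exact ENNReal.ofReal_le_ofReal (by linarith)

/-- The probability that a centered Gaussian variable is at least one standard deviation. -/
noncomputable def oneSigmaProb : ℝ := (gaussianReal 0 1).real (Set.Ici 1)

theorem oneSigmaProb_pos : 0 < oneSigmaProb := by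
  refine ENNReal.toReal_pos (fun h => ?_) (measure_ne_top _ _)
  have := gaussianReal_absolutelyContinuous' 0 one_ne_zero h
  simp at this

theorem IsTreeLabel.oneSigmaProb_le (hZ : IsTreeLabel f Z P) [IsProbabilityMeasure P]
    {u v : unitInterval} {θ : ℝ} (hθ : 0 < θ) (h : θ ^ 2 ≤ treeDist f u v) :
    oneSigmaProb ≤ P.real {ω | θ ≤ Z u ω - Z v ω} := by
  have hmap := hZ.map_sub u v
  set d := treeDist f u v
  have hd : θ ≤ √d := Real.le_sqrt_of_sq_le h
  have hstd : gaussianReal 0 d.toNNReal = (gaussianReal 0 1).map (√d * ·) := by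
    rw [gaussianReal_map_const_mul, mul_zero, mul_one]
    congr 1
    ext
    rw [Real.coe_toNNReal _ (treeDist_nonneg f u v)]
    exact (Real.sq_sqrt (treeDist_nonneg f u v)).symm
  have e : P.real {ω | θ ≤ Z u ω - Z v ω} =
      (gaussianReal 0 1).real ((√d * ·) ⁻¹' Set.Ici θ) := by
    rw [measureReal_def, measureReal_def, ← Measure.map_apply (measurable_const_mul _)
      measurableSet_Ici, ← hstd, ← hmap, Measure.map_apply_of_aemeasurable
      (hZ.aemeasurable_sub u v) measurableSet_Ici]
    rfl
  rw [e]
  refine measureReal_mono fun x hx => ?_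
  change θ ≤ √d * x
  nlinarith [show (1 : ℝ) ≤ x from hx]

end Gaussian

/-- The second moment method: among pairwise independent events of probability at least `p`, a
proportion of at least `p / 2` occurs, with high probability. -/
theorem measure_card_le_of_pairwise_indepFun {Ω ι : Type*} [MeasurableSpace Ω] {P : Measure Ω}
    [IsProbabilityMeasure P] {Y : ι → Ω → ℝ} {S : Finset ι} {θ p : ℝ} (hp : 0 < p)
    (hY : ∀ i ∈ S, AEMeasurable (Y i) P)
    (hindep : Set.Pairwise ↑S fun i j => IndepFun (Y i) (Y j) P)
    (hprob : ∀ i ∈ S, p ≤ P.real {ω | θ ≤ Y i ω}) (hS : 0 < S.card) :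
    P {ω | ((S.filter fun i => θ ≤ Y i ω).card : ℝ) ≤ p * S.card / 2} ≤
      ENNReal.ofReal (4 / (p ^ 2 * S.card)) := by
  classical
  set φ : ℝ → ℝ := (Set.Ici θ).indicator 1 with hφ
  have hφm : Measurable φ := measurable_one.indicator measurableSet_Ici
  have hφ01 : ∀ x, φ x ∈ Set.Icc (0 : ℝ) 1 := fun x => by
    by_cases h : x ∈ Set.Ici θ <;> simp [φ, h]
  set X : ι → Ω → ℝ := fun i => φ ∘ Y i with hX
  have hXm : ∀ i ∈ S, AEMeasurable (X i) P := fun i hi => hφm.comp_aemeasurable (hY i hi)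
  have hXLp : ∀ i ∈ S, MemLp (X i) 2 P := fun i hi =>
    memLp_of_bounded (ae_of_all _ fun ω => hφ01 _) (hXm i hi).aestronglyMeasurable 2
  have hXint : ∀ i ∈ S, p ≤ ∫ ω, X i ω ∂P := fun i hi => by
    refine (hprob i hi).trans_eq ?_
    have hset : NullMeasurableSet {ω | θ ≤ Y i ω} P :=
      nullMeasurableSet_le aemeasurable_const (hY i hi)
    have : X i = {ω | θ ≤ Y i ω}.indicator fun _ => (1 : ℝ) := by
      ext ω
      by_cases h : θ ≤ Y i ω <;> simp [X, φ, h]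
    rw [this, integral_indicator₀ hset]
    simp
  have hvar : variance (∑ i ∈ S, X i) P ≤ S.card := by
    rw [IndepFun.variance_sum hXLp fun i hi j hj hij => (hindep hi hj hij).comp hφm hφm]
    refine (Finset.sum_le_card_nsmul S _ 1 fun i hi => ?_).trans (by simp)
    have := variance_le_sq_of_bounded (ae_of_all P fun ω => hφ01 (Y i ω)) (hXm i hi)
    refine this.trans (by norm_num)
  have hmean : p * S.card ≤ ∫ ω, (∑ i ∈ S, X i) ω ∂P := by
    simp only [Finset.sum_apply]
    rw [integral_finsetSum _ fun i hi => (hXLp i hi).integrable one_le_two, mul_comm,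
      ← nsmul_eq_mul]
    exact Finset.card_nsmul_le_sum S _ p hXint
  have hcard : ∀ ω, (∑ i ∈ S, X i) ω = ((S.filter fun i => θ ≤ Y i ω).card : ℝ) := fun ω => by
    rw [Finset.sum_apply, Finset.card_filter]
    push_cast
    refine Finset.sum_congr rfl fun i _ => ?_
    by_cases h : θ ≤ Y i ω <;> simp [X, φ, h]
  have hScard : (0 : ℝ) < S.card := by exact_mod_cast hS
  have hpos : 0 < p * S.card / 2 := by positivity
  refine (measure_mono fun ω hω => ?_).trans ((meas_ge_le_variance_div_sq
    (memLp_finsetSum' S hXLp) hpos).trans (ENNReal.ofReal_le_ofReal ?_))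
  · change ((S.filter fun i => θ ≤ Y i ω).card : ℝ) ≤ p * S.card / 2 at hω
    change p * S.card / 2 ≤ |_|
    rw [hcard, abs_sub_comm]
    exact (by linarith : p * S.card / 2 ≤ _).trans (le_abs_self _)
  · calc variance (∑ i ∈ S, X i) P / (p * S.card / 2) ^ 2
        ≤ S.card / (p * S.card / 2) ^ 2 := by gcongr
      _ = 4 / (p ^ 2 * S.card) := by field_simp; ring

/-! ### Many separated points -/

theorem minBetween_eq_of_forall_le (f : C(unitInterval, ℝ)) {w a v : unitInterval} (hwa : w ≤ a)
    (hav : a ≤ v) (h : ∀ u ∈ Set.Icc a v, f a ≤ f u) : minBetween f w v = minBetween f w a := by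
  apply le_antisymm
  · refine le_minBetween f fun u hu => minBetween_le f ?_
    rw [Set.uIcc_of_le hwa] at hu
    rw [Set.uIcc_of_le (hwa.trans hav)]
    exact ⟨hu.1, hu.2.trans hav⟩
  · refine le_minBetween f fun u hu => ?_
    rw [Set.uIcc_of_le (hwa.trans hav)] at hu
    rcases le_total u a with h' | h'
    · exact minBetween_le f (by rw [Set.uIcc_of_le hwa]; exact ⟨hu.1, h'⟩)
    · exact (minBetween_le f Set.right_mem_uIcc).trans (h u ⟨h', hu.2⟩)

/-- Separated points of the tree, sorted by height: at least a fixed proportion of them lies in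
distinct branches above a common level. -/
theorem exists_common_level {f : C(unitInterval, ℝ)} (hf : IsExcursion f) {S : Finset unitInterval}
    {y δ w : ℝ} (hw : 0 < w) (hrange : ∀ u ∈ S, y ≤ f u ∧ f u ≤ y + δ)
    (hsep : ∀ u ∈ S, ∀ v ∈ S, u ≠ v → 4 * w ≤ treeDist f u v) {K q : ℕ} (hK : δ < K * w)
    (hq : 0 < q) (hS : K * q < S.card) :
    ∃ T ⊆ S, q < T.card ∧ ∃ h, 0 ≤ h ∧ (∀ u ∈ T, h + w ≤ f u) ∧
      ∀ u ∈ T, ∀ v ∈ T, u ≠ v → minBetween f u v < h := by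
  classical
  -- Separated points in one height band of width `w` branch off at least `w` below the band.
  obtain ⟨j, -, hj⟩ := Finset.exists_lt_card_fiber_of_mul_lt_card_of_maps_to
    (s := S) (t := Finset.range K) (f := fun u => ⌊(f u - y) / w⌋₊) (n := q)
    (fun u hu => by
      rw [Finset.mem_range, Nat.floor_lt (div_nonneg (sub_nonneg.2 (hrange u hu).1) hw.le),
        div_lt_iff₀ hw]
      linarith [(hrange u hu).2]) (by simpa using hS)
  set T := S.filter fun u => ⌊(f u - y) / w⌋₊ = j
  have hband : ∀ u ∈ T, y + j * w ≤ f u ∧ f u < y + (j + 1) * w := by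
    intro u hu
    rw [Finset.mem_filter] at hu
    have h0 := div_nonneg (sub_nonneg.2 (hrange u hu.1).1) hw.le
    have h1 := Nat.floor_le h0
    have h2 := Nat.lt_floor_add_one ((f u - y) / w)
    rw [hu.2, le_div_iff₀ hw] at h1
    rw [hu.2, div_lt_iff₀ hw] at h2
    constructor <;> linarith
  have hmin : ∀ u ∈ T, ∀ v ∈ T, u ≠ v → minBetween f u v < y + j * w - w := by
    intro u hu v hv huv
    have h1 := hsep u (Finset.mem_filter.1 hu).1 v (Finset.mem_filter.1 hv).1 huv
    have h2 := hband u hu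
    have h3 := hband v hv
    unfold treeDist at h1
    linarith
  refine ⟨T, Finset.filter_subset _ _, hj, y + j * w - w, ?_, fun u hu => ?_, hmin⟩
  · obtain ⟨u, hu, v, hv, huv⟩ := Finset.one_lt_card.1 (show 1 < T.card by omega)
    refine le_trans ?_ (hmin u hu v hv huv).le
    exact le_minBetween f fun x _ => hf.nonneg x
  · linarith [(hband u hu).1]

theorem notMem_Ioo_of_minBetween_lt {f : C(unitInterval, ℝ)} {a b u v : unitInterval}
    (h : IsExcursionInterval f a b) (hu : u ∈ Set.Ioo a b) (huv : minBetween f u v < f a) :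
    v ∉ Set.Ioo a b := by
  intro hv
  obtain ⟨x, hx, he⟩ := exists_minBetween_eq f u v
  have := h.above x (Set.ordConnected_Ioo.uIcc_subset hu hv hx)
  linarith

/-- The label increment along a branch is independent of any earlier increment outside it: the branch
hangs on the tree at the time `a'`, so that `u'` and `a'` have the same covariance with earlier
times. -/
theorem IsTreeLabel.indepFun_of_excursionInterval {f : C(unitInterval, ℝ)} {Ω : Type*}
    [MeasurableSpace Ω] {P : Measure Ω} {Z : unitInterval → Ω → ℝ} (hZ : IsTreeLabel f Z P)
    {a u a' b' u' : unitInterval} (h' : IsExcursionInterval f a' b') (hu : a ≤ u)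
    (hu' : u' ∈ Set.Ioo a' b') (h2 : u ∉ Set.Ioo a' b') (hlt : u < u') :
    IndepFun (fun ω => Z u ω - Z a ω) (fun ω => Z u' ω - Z a' ω) P := by
  have hprob := hZ.gaussian.isProbabilityMeasure
  refine (hZ.isGaussianProcess_sub.hasGaussianLaw_prodMk (s := (u, a))
    (t := (u', a'))).indepFun_of_covariance_eq_zero ?_
  have hua' : u ≤ a' := by
    by_contra! hcon
    exact h2 ⟨hcon, hlt.trans hu'.2⟩
  have hle : ∀ x ∈ Set.Icc a' u', f a' ≤ f x := by
    intro x hx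
    rcases hx.1.eq_or_lt with rfl | hlt'
    · exact le_rfl
    · exact (h'.above x ⟨hlt', hx.2.trans_lt hu'.2⟩).le
  rw [covariance_eq_sub (hZ.isGaussianProcess_sub.hasGaussianLaw_eval (u, a)).memLp_two
    (hZ.isGaussianProcess_sub.hasGaussianLaw_eval (u', a')).memLp_two, hZ.integral_sub,
    zero_mul, sub_zero]
  refine (hZ.integral_sub_mul_sub u a u' a').trans ?_
  rw [minBetween_eq_of_forall_le f hua' hu'.1.le hle,
    minBetween_eq_of_forall_le f (hu.trans hua') hu'.1.le hle]
  ring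

/-- Many separated points in the tree produce, with high probability, many separated points for
the distance `D`. -/
theorem IsTreeLabel.exists_separated {f : C(unitInterval, ℝ)} (hf : IsExcursion f) {Ω : Type*}
    [MeasurableSpace Ω] {P : Measure Ω} [IsProbabilityMeasure P] {Z : unitInterval → Ω → ℝ}
    (hZ : IsTreeLabel f Z P) {S : Finset unitInterval} {y δ σ : ℝ} (hσ : 0 < σ)
    (hrange : ∀ u ∈ S, y ≤ f u ∧ f u ≤ y + δ)
    (hsep : ∀ u ∈ S, ∀ v ∈ S, u ≠ v → σ ^ 2 ≤ treeDist f u v) {K q : ℕ}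
    (hK : δ < K * (σ ^ 2 / 4)) (hq : 0 < q) (hS : K * q < S.card) :
    ∃ E : Set Ω, P E ≤ ENNReal.ofReal (4 / (oneSigmaProb ^ 2 * q)) ∧
      ∀ ω ∉ E, ∀ z : C(unitInterval, ℝ), (∀ t, z t = Z t ω) → LabelCompatible f z →
        ∃ T ⊆ S, oneSigmaProb * q / 2 < T.card ∧
          ∀ u ∈ T, ∀ v ∈ T, u ≠ v → σ ≤ brownianDist f z u v := by
  classical
  obtain ⟨T, hTS, hTq, h, h0, hheight, hmin⟩ := exists_common_level hf (w := σ ^ 2 / 4)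
    (by positivity) hrange (fun u hu v hv huv => by linarith [hsep u hu v hv huv]) hK hq hS
  have hexc : ∀ u, ∃ a b, u ∈ T → IsExcursionInterval f a b ∧ u ∈ Set.Ioo a b ∧ f a = h := by
    intro u
    by_cases hu : u ∈ T
    · have : 0 < σ ^ 2 / 4 := by positivity
      obtain ⟨a, b, hab⟩ := exists_excursionInterval hf h0
        (show h < f u by linarith [hheight u hu])
      exact ⟨a, b, fun _ => hab⟩
    · exact ⟨u, u, fun h => absurd h hu⟩
  choose a b hab using hexc
  have hout : ∀ u ∈ T, ∀ v ∈ T, u ≠ v → v ∉ Set.Ioo (a u) (b u) := fun u hu v hv huv =>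
    notMem_Ioo_of_minBetween_lt (hab u hu).1 (hab u hu).2.1
      (by rw [(hab u hu).2.2]; exact hmin u hu v hv huv)
  have hindep : Set.Pairwise ↑T fun u v =>
      IndepFun (fun ω => Z u ω - Z (a u) ω) (fun ω => Z v ω - Z (a v) ω) P := by
    intro u hu v hv huv
    rcases lt_or_gt_of_ne huv with hlt | hlt
    · exact hZ.indepFun_of_excursionInterval (hab v hv).1 (hab u hu).2.1.1.le
        (hab v hv).2.1 (hout v hv u hu huv.symm) hlt
    · exact (hZ.indepFun_of_excursionInterval (hab u hu).1 (hab v hv).2.1.1.le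
        (hab u hu).2.1 (hout u hu v hv huv) hlt).symm
  have hprob : ∀ u ∈ T, oneSigmaProb ≤ P.real {ω | σ / 2 ≤ Z u ω - Z (a u) ω} := by
    intro u hu
    refine hZ.oneSigmaProb_le (half_pos hσ) ?_
    obtain ⟨hexc, hmem, hlev⟩ := hab u hu
    have h1 : minBetween f u (a u) ≤ f (a u) := minBetween_le f Set.right_mem_uIcc
    have h2 := hheight u hu
    unfold treeDist
    rw [div_pow]
    linarith
  have hTpos : 0 < T.card := by omega
  have hp := oneSigmaProb_pos
  refine ⟨_, (measure_card_le_of_pairwise_indepFun hp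
    (fun u hu => hZ.aemeasurable_sub u (a u)) hindep hprob hTpos).trans
      (ENNReal.ofReal_le_ofReal ?_), fun ω hω z hz hcompat => ?_⟩
  · have : (q : ℝ) ≤ T.card := by exact_mod_cast hTq.le
    have hq' : (0 : ℝ) < q := by exact_mod_cast hq
    gcongr
  · rw [Set.mem_ofPred_eq, not_le] at hω
    refine ⟨_, (Finset.filter_subset _ _).trans hTS, lt_of_le_of_lt ?_ hω, ?_⟩
    · have : (q : ℝ) ≤ T.card := by exact_mod_cast hTq.le
      gcongr
    · intro u hu v hv huv
      rw [Finset.mem_filter, ← hz, ← hz] at hu hv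
      have := brownianDist_ge_add_of_disjoint hcompat (hab u hu.1).1 (hab v hv.1).1
        (hab u hu.1).2.1 (hab v hv.1).2.1 (hout u hu.1 v hv.1 huv) (hout v hv.1 u hu.1 huv.symm)
      linarith [hu.2, hv.2]

/-! ### Tree entropy against label oscillation -/

/-- The event that the labels of the times in `D` deviate from the label of `u₀` by more
than `Λ`. -/
def deviationEvent {Ω : Type*} (Z : unitInterval → Ω → ℝ) (D : Set unitInterval)
    (u₀ : unitInterval) (Λ : ℝ) : Set Ω :=
  {ω | ∃ u ∈ D, Λ < |Z u ω - Z u₀ ω|}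

/-- The event that the labels are continuous and factor through the tree, but that the resulting
space has no `N` points with comparable mutual distances. -/
def noNearSimplexEvent {Ω : Type*} (f : C(unitInterval, ℝ)) (Z : unitInterval → Ω → ℝ) (N : ℕ) :
    Set Ω :=
  {ω | ∃ z : C(unitInterval, ℝ), (∀ t, z t = Z t ω) ∧ LabelCompatible f z ∧
    HasNoNearSimplex (LabelledInterval f z) N}

theorem brownianDist_le_four_mul (f : C(unitInterval, ℝ)) {z : C(unitInterval, ℝ)}
    {x y u₀ : unitInterval} {Λ : ℝ} (h : ∀ u ∈ Set.Icc x y, |z u - z u₀| ≤ Λ)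
    {u v : unitInterval} (hu : u ∈ Set.Icc x y) (hv : v ∈ Set.Icc x y) :
    brownianDist f z u v ≤ 4 * Λ := by
  have hmin : ∀ p ∈ Set.Icc x y, z u₀ - Λ ≤ z p := fun p hp => by
    linarith [(abs_le.1 (h p hp)).1]
  have hle := labelDist_le_of_forall_le z (s := u) (t := v) (c := z u₀ - Λ) (by
    rcases le_total u v with huv | huv
    · left
      rw [cyclicIcc, if_pos huv]
      exact fun p hp => hmin p ⟨hu.1.trans hp.1, hp.2.trans hv.2⟩
    · right
      rw [cyclicIcc, if_pos huv]
      exact fun p hp => hmin p ⟨hv.1.trans hp.1, hp.2.trans hu.2⟩)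
  have h1 := (abs_le.1 (h u hu)).2
  have h2 := (abs_le.1 (h v hv)).2
  linarith [brownianDist_le_labelDist f z u v]

/-- A stretch `[x, y]` of time on which `f` varies by at most `δ`, together with a base point `u₀` and
a countable dense set `D` of times. The set `D` makes suprema of labels measurable, and reduces
them to countably many labels. -/
structure IsWindow (f : C(unitInterval, ℝ)) (x y u₀ : unitInterval) (D : Set unitInterval)
    (δ : ℝ) : Prop where
  pos : 0 < δ
  base_mem : u₀ ∈ Set.Icc x y
  countable : D.Countable
  subset : D ⊆ Set.Icc x y
  dense : Set.Icc x y ⊆ closure D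
  range : ∃ c, ∀ u ∈ Set.Icc x y, c ≤ f u ∧ f u ≤ c + δ

theorem IsWindow.abs_sub_le {f : C(unitInterval, ℝ)} {x y u₀ : unitInterval}
    {D : Set unitInterval} {δ : ℝ} (hW : IsWindow f x y u₀ D δ) {Ω : Type*}
    {Z : unitInterval → Ω → ℝ} {ω : Ω} (z : C(unitInterval, ℝ)) (hz : ∀ t, z t = Z t ω) {Λ : ℝ}
    (hω : ω ∉ deviationEvent Z D u₀ Λ) : ∀ u ∈ Set.Icc x y, |z u - z u₀| ≤ Λ := by
  have hclosed : IsClosed {u | |z u - z u₀| ≤ Λ} :=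
    isClosed_le (z.continuous.sub continuous_const).abs continuous_const
  have hsub : D ⊆ {u | |z u - z u₀| ≤ Λ} := fun u hu => by
    by_contra hcon
    refine hω ⟨u, hu, ?_⟩
    rw [← hz, ← hz]
    exact not_le.1 hcon
  exact fun u hu => hclosed.closure_subset_iff.2 hsub (hW.dense hu)

theorem IsWindow.treeDist_le {f : C(unitInterval, ℝ)} {x y u₀ : unitInterval}
    {D : Set unitInterval} {δ : ℝ} (hW : IsWindow f x y u₀ D δ) {u v : unitInterval}
    (hu : u ∈ Set.Icc x y) (hv : v ∈ Set.Icc x y) : treeDist f u v ≤ 4 * δ := by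
  obtain ⟨c, hc⟩ := hW.range
  have : c ≤ minBetween f u v :=
    le_minBetween f fun p hp => (hc p (Set.ordConnected_Icc.uIcc_subset hu hv hp)).1
  unfold treeDist
  linarith [(hc u hu).2, (hc v hv).2, hW.pos]

section

variable {f : C(unitInterval, ℝ)} {Ω : Type*} [MeasurableSpace Ω] {P : Measure Ω}
  [IsProbabilityMeasure P] {Z : unitInterval → Ω → ℝ}

/-- If there are no near-simplices of size `N` with probability at least `b`, then the deviation
bound `2 ^ m * √δ` for the labels entails bounds for the covering numbers of the tree, with a
constant `B` that does not depend on the window. -/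
theorem IsTreeLabel.exists_card_le (hf : IsExcursion f) (hZ : IsTreeLabel f Z P) (N : ℕ) {b : ℝ}
    (hb : 0 < b) (hN : ENNReal.ofReal b ≤ P (noNearSimplexEvent f Z N)) :
    ∃ B : ℕ, 0 < B ∧ ∀ (x y u₀ : unitInterval) (D : Set unitInterval) (δ : ℝ),
      IsWindow f x y u₀ D δ → ∀ m : ℕ,
        P (deviationEvent Z D u₀ (2 ^ m * √δ)) ≤ ENNReal.ofReal (b / 4) →
          ∀ (j : ℕ) (S : Finset unitInterval), (∀ u ∈ S, u ∈ Set.Icc x y) →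
            (∀ u ∈ S, ∀ v ∈ S, u ≠ v → δ / 4 ^ j ≤ treeDist f u v) →
              S.card ≤ B ^ (m + j + 1) := by
  set p := oneSigmaProb with hp
  have hp0 : 0 < p := oneSigmaProb_pos
  obtain ⟨q₀, hq₀⟩ := exists_nat_ge (16 / (p ^ 2 * b))
  obtain ⟨c, hc⟩ := exists_nat_ge (2 / p)
  refine ⟨8 * ((q₀ + c + 1) * (N + 1) ^ 3), by positivity, ?_⟩
  intro x y u₀ D δ hW m hdev j S hSI hSsep
  have hδ := hW.pos
  obtain ⟨y₀, hrange⟩ := hW.range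
  -- `q₀` makes the failure probability of the second moment method at most `b / 4`; the other term
  -- is the number of points that the doubling property allows.
  set q := q₀ + 1 + c * N ^ (m + j + 3) with hq
  have hq_pos : 0 < q := by positivity
  set σ := √δ / 2 ^ j with hσ
  have hσpos : 0 < σ := by positivity
  have hσsq : σ ^ 2 = δ / 4 ^ j := by
    rw [hσ, div_pow, Real.sq_sqrt hδ.le, ← pow_mul, mul_comm, pow_mul]
    norm_num
  have hcard : S.card ≤ (4 ^ (j + 1) + 1) * q := by
    by_contra! hcon
    obtain ⟨E, hE, hsep⟩ := hZ.exists_separated hf hσpos (fun u hu => hrange u (hSI u hu))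
      (by rwa [hσsq]) (K := 4 ^ (j + 1) + 1) (q := q) (by
        rw [hσsq]
        push_cast
        rw [pow_succ]
        field_simp
        nlinarith [show (0 : ℝ) < 4 ^ j by positivity]) hq_pos hcon
    have hE' : P E ≤ ENNReal.ofReal (b / 4) := by
      refine hE.trans (ENNReal.ofReal_le_ofReal ?_)
      have h1 : 16 / (p ^ 2 * b) ≤ q := hq₀.trans (by
        rw [hq]
        push_cast
        have : (0 : ℝ) ≤ c * N ^ (m + j + 3) := by positivity
        linarith)
      have hq' : (0 : ℝ) < q := by exact_mod_cast hq_pos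
      rw [div_le_iff₀ (by positivity)] at h1 ⊢
      linarith
    have hlt : P (E ∪ deviationEvent Z D u₀ (2 ^ m * √δ)) < P (noNearSimplexEvent f Z N) := by
      refine (measure_union_le _ _).trans_lt ((add_le_add hE' hdev).trans_lt (lt_of_lt_of_le ?_ hN))
      rw [← ENNReal.ofReal_add (by positivity) (by positivity)]
      exact (ENNReal.ofReal_lt_ofReal_iff hb).2 (by linarith)
    obtain ⟨ω, hω, hω'⟩ : ∃ ω ∈ noNearSimplexEvent f Z N,
        ω ∉ E ∪ deviationEvent Z D u₀ (2 ^ m * √δ) := by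
      by_contra! hsub
      exact (measure_mono hsub).not_gt hlt
    obtain ⟨z, hz, hcompat, hdoub⟩ := hω
    obtain ⟨T, hTS, hTcard, hT⟩ := hsep ω (fun h => hω' (Or.inl h)) z hz hcompat
    have hosc := hW.abs_sub_le z hz fun h => hω' (Or.inr h)
    have hTN : T.card ≤ N ^ (m + j + 3) := by
      refine hdoub.card_le (m + j + 3) hσpos (4 * (2 ^ m * √δ)) T (fun u hu v hv huv =>
        ⟨hT u hu v hv huv, brownianDist_le_four_mul f hosc (hSI u (hTS hu)) (hSI v (hTS hv))⟩) ?_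
      have e : (2 : ℝ) ^ (m + j + 3) * σ = 8 * (2 ^ m * √δ) := by
        rw [hσ, pow_add, pow_add]
        field_simp
        norm_num
      rw [e]
      have : 0 < 2 ^ m * √δ := by positivity
      linarith
    have h1 : (T.card : ℝ) ≤ N ^ (m + j + 3) := by exact_mod_cast hTN
    have h2 : (N : ℝ) ^ (m + j + 3) ≤ p * q / 2 := by
      have h3 : (1 : ℝ) ≤ p * c / 2 := by
        rw [div_le_iff₀ hp0] at hc
        linarith
      have h4 : (0 : ℝ) ≤ N ^ (m + j + 3) := by positivity
      have h5 : (0 : ℝ) ≤ p * (q₀ + 1) / 2 := by positivity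
      rw [hq]
      push_cast
      nlinarith
    linarith
  calc S.card ≤ (4 ^ (j + 1) + 1) * q := hcard
    _ ≤ 8 ^ (m + j + 1) * ((q₀ + c + 1) * (N + 1) ^ (3 * (m + j + 1))) := by
        gcongr
        · calc 4 ^ (j + 1) + 1 ≤ 4 ^ (j + 1) * 2 ^ (j + 1) := by
                have h1 : 2 ≤ 2 ^ (j + 1) := by
                  rw [pow_succ]
                  have := Nat.one_le_two_pow (n := j)
                  omega
                have h2 := Nat.one_le_pow (j + 1) 4 (by norm_num)
                nlinarith
            _ = 8 ^ (j + 1) := by rw [← mul_pow]; norm_num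
            _ ≤ 8 ^ (m + j + 1) := Nat.pow_le_pow_right (by norm_num) (by omega)
        · have h1 : N ^ (m + j + 3) ≤ (N + 1) ^ (3 * (m + j + 1)) :=
            (Nat.pow_le_pow_left (Nat.le_succ N) _).trans
              (Nat.pow_le_pow_right (by omega) (by omega))
          have h2 : 1 ≤ (N + 1) ^ (3 * (m + j + 1)) := Nat.one_le_pow _ _ (by omega)
          rw [hq]
          nlinarith [Nat.mul_le_mul_left c h1]
    _ ≤ (8 * ((q₀ + c + 1) * (N + 1) ^ 3)) ^ (m + j + 1) := by
        rw [mul_pow, mul_pow, ← pow_mul]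
        gcongr
        exact Nat.le_self_pow (by omega) _

/-- Maximal `r`-separated subsets exist as soon as the separated subsets have bounded
cardinality. -/
theorem exists_net (f : C(unitInterval, ℝ)) (J : Set unitInterval) {r : ℝ} (hr : 0 < r) {n : ℕ}
    (hn : ∀ S : Finset unitInterval, (∀ u ∈ S, u ∈ J) →
      (∀ u ∈ S, ∀ v ∈ S, u ≠ v → r ≤ treeDist f u v) → S.card ≤ n) :
    ∃ S : Finset unitInterval, (∀ u ∈ S, u ∈ J) ∧ S.card ≤ n ∧
      ∀ u ∈ J, ∃ v ∈ S, treeDist f u v < r := by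
  classical
  let p : ℕ → Prop := fun k => ∃ S : Finset unitInterval, S.card = k ∧ (∀ u ∈ S, u ∈ J) ∧
    ∀ u ∈ S, ∀ v ∈ S, u ≠ v → r ≤ treeDist f u v
  have hp0 : p 0 := ⟨∅, by simp⟩
  obtain ⟨S, hcard, hSJ, hS⟩ : p (Nat.findGreatest p n) := Nat.findGreatest_spec (Nat.zero_le n) hp0
  refine ⟨S, hSJ, hn S hSJ hS, fun u hu => ?_⟩
  by_contra! hcon
  have huS : u ∉ S := fun h => by
    have := hcon u h
    rw [treeDist_self] at this
    linarith
  have hins : p (S.card + 1) := by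
    refine ⟨insert u S, Finset.card_insert_of_notMem huS, fun v hv => ?_, fun v hv w hw hvw => ?_⟩
    · rcases Finset.mem_insert.1 hv with rfl | hv'
      exacts [hu, hSJ v hv']
    · rcases Finset.mem_insert.1 hv with rfl | hv' <;> rcases Finset.mem_insert.1 hw with rfl | hw'
      · exact absurd rfl hvw
      · exact hcon w hw'
      · rw [treeDist_comm]
        exact hcon v hv'
      · exact hS v hv' w hw' hvw
  obtain ⟨S', hcard', hSJ', hS'⟩ := hins
  have h1 := Nat.le_findGreatest (P := p) (hcard' ▸ hn S' hSJ' hS') ⟨S', hcard', hSJ', hS'⟩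
  omega

/-- The sum of `(i + 1) / 2 ^ i` over `i < j` is `4 - (2 * j + 4) / 2 ^ j`; this is the induction
step. -/
theorem chain_sum_step (j : ℕ) : (4 - (2 * j + 4) / 2 ^ j : ℝ) + (j + 1) / 2 ^ j =
    4 - (2 * (j + 1 : ℕ) + 4) / 2 ^ (j + 1) := by
  push_cast
  rw [pow_succ]
  field_simp
  ring

/-- Chaining: bounds for the covering numbers of the tree entail bounds for the labels. -/
theorem IsTreeLabel.exists_deviation_le (hZ : IsTreeLabel f Z P) {b : ℝ} (hb : 0 < b) {B : ℕ}
    (hB : 0 < B) : ∃ C : ℝ, 0 < C ∧ ∀ (x y u₀ : unitInterval) (D : Set unitInterval) (δ : ℝ),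
      IsWindow f x y u₀ D δ → ∀ m : ℕ,
        (∀ (j : ℕ) (S : Finset unitInterval), (∀ u ∈ S, u ∈ Set.Icc x y) →
            (∀ u ∈ S, ∀ v ∈ S, u ≠ v → δ / 4 ^ j ≤ treeDist f u v) →
              S.card ≤ B ^ (m + j + 1)) →
        P (deviationEvent Z D u₀ (C * (m + 1) * √δ)) ≤ ENNReal.ofReal (b / 4) := by
  classical
  -- `c` is large enough for the exponential tails to beat the covering numbers.
  set θ := min (1 / 2) (b / 32) with hθ
  have hθ0 : 0 < θ := by positivity
  have hB' : (0 : ℝ) < B := by exact_mod_cast hB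
  set c := (B : ℝ) / θ with hc
  have hc0 : 0 < c := by positivity
  have hcθ : B * Real.exp (-c) ≤ θ := by
    rw [Real.exp_neg, ← div_eq_mul_inv, div_le_iff₀ (Real.exp_pos _)]
    have : c ≤ Real.exp c := by linarith [Real.add_one_le_exp c]
    calc (B : ℝ) = θ * c := by rw [hc]; field_simp
      _ ≤ θ * Real.exp c := by gcongr
  refine ⟨9 * c, by positivity, fun x y u₀ D δ hW m hcard => ?_⟩
  have hδ := hW.pos
  have hsqrt : 0 < √δ := Real.sqrt_pos.2 hδ
  have hnet : ∀ j : ℕ, ∃ S : Finset unitInterval, (∀ u ∈ S, u ∈ Set.Icc x y) ∧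
      S.card ≤ B ^ (m + j + 1) ∧ ∀ u ∈ Set.Icc x y, ∃ v ∈ S, treeDist f u v < δ / 4 ^ j :=
    fun j => exists_net f _ (by positivity) (hcard j)
  choose N hNI hNcard hNnet using hnet
  -- The nets, preceded by the base point.
  let T : ℕ → Finset unitInterval := fun j => if j = 0 then {u₀} else N (j - 1)
  have hT0 : T 0 = {u₀} := rfl
  have hTs : ∀ j, T (j + 1) = N j := fun j => by simp [T]
  have hpar : ∀ j u, ∃ v, u ∈ Set.Icc x y → v ∈ T j ∧ treeDist f u v ≤ (2 * √δ / 2 ^ j) ^ 2 := by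
    intro j u
    by_cases hu : u ∈ Set.Icc x y
    · have e : (2 * √δ / 2 ^ j) ^ 2 = 4 * δ / 4 ^ j := by
        rw [div_pow, mul_pow, Real.sq_sqrt hδ.le, ← pow_mul, mul_comm j, pow_mul]
        norm_num
      rw [e]
      cases j with
      | zero =>
        refine ⟨u₀, fun _ => ⟨by simp [hT0], ?_⟩⟩
        rw [pow_zero, div_one]
        exact hW.treeDist_le hu hW.base_mem
      | succ j =>
        obtain ⟨v, hv, hlt⟩ := hNnet j u hu
        refine ⟨v, fun _ => ⟨by rwa [hTs], hlt.le.trans_eq ?_⟩⟩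
        rw [pow_succ]
        field_simp
    · exact ⟨u, fun h => absurd h hu⟩
  choose par hpar using hpar
  let F : ℕ → Set Ω := fun j => ⋃ u ∈ N j,
    {ω | c * (m + j + 1) * (2 * √δ / 2 ^ j) ≤ |Z u ω - Z (par j u) ω|}
  have hF : ∀ j, P (F j) ≤ ENNReal.ofReal (4 * θ * (1 / 2) ^ j) := by
    intro j
    have hexp : (B : ℝ) ^ (m + j + 1) * Real.exp (-(c * (m + j + 1))) ≤ θ * (1 / 2) ^ j := by
      have e : Real.exp (-(c * (m + j + 1))) = Real.exp (-c) ^ (m + j + 1) := by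
        rw [← Real.exp_nat_mul]
        push_cast
        ring_nf
      rw [e, ← mul_pow]
      have hθ1 : θ ≤ 1 / 2 := min_le_left _ _
      calc (B * Real.exp (-c)) ^ (m + j + 1) ≤ θ ^ (m + j + 1) := by gcongr
        _ ≤ θ ^ (j + 1) := pow_le_pow_of_le_one hθ0.le (by linarith) (by omega)
        _ = θ * θ ^ j := pow_succ' _ _
        _ ≤ θ * (1 / 2) ^ j := by gcongr
    calc P (F j) ≤ ∑ u ∈ N j, P {ω | c * (m + j + 1) * (2 * √δ / 2 ^ j) ≤
            |Z u ω - Z (par j u) ω|} := measure_biUnion_finset_le _ _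
      _ ≤ ∑ u ∈ N j, ENNReal.ofReal (4 * Real.exp (-(c * (m + j + 1)))) :=
          Finset.sum_le_sum fun u hu => hZ.measure_le_abs_sub (by positivity)
            (hpar j u (hNI j u hu)).2 _
      _ = (N j).card * ENNReal.ofReal (4 * Real.exp (-(c * (m + j + 1)))) := by simp
      _ = ENNReal.ofReal ((N j).card * (4 * Real.exp (-(c * (m + j + 1))))) := by
          rw [ENNReal.ofReal_mul (p := ((N j).card : ℝ)) (by positivity), ENNReal.ofReal_natCast]
      _ ≤ ENNReal.ofReal (4 * θ * (1 / 2) ^ j) := by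
          refine ENNReal.ofReal_le_ofReal ?_
          have h1 : ((N j).card : ℝ) ≤ (B : ℝ) ^ (m + j + 1) := by exact_mod_cast hNcard j
          have h2 : ((N j).card : ℝ) * Real.exp (-(c * (m + j + 1))) ≤
              (B : ℝ) ^ (m + j + 1) * Real.exp (-(c * (m + j + 1))) := by gcongr
          linarith
  have hFsum : P (⋃ j, F j) ≤ ENNReal.ofReal (b / 4) := by
    refine (measure_iUnion_le _).trans ((ENNReal.tsum_le_tsum hF).trans ?_)
    rw [← ENNReal.ofReal_tsum_of_nonneg (fun j => by positivity)
      (summable_geometric_two.mul_left _), tsum_mul_left, tsum_geometric_two]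
    exact ENNReal.ofReal_le_ofReal (by linarith [min_le_right (1 / 2) (b / 32)])
  have hchain : ∀ ω ∉ ⋃ j, F j, ∀ j, ∀ u ∈ T j, |Z u ω - Z u₀ ω| ≤
      2 * √δ * c * (m + 1) * (4 - (2 * j + 4) / 2 ^ j) := by
    intro ω hω j
    induction j with
    | zero =>
      intro u hu
      rw [hT0, Finset.mem_singleton] at hu
      simp [hu]
    | succ j ih =>
      intro u hu
      rw [hTs] at hu
      have h1 := hpar j u (hNI j u hu)
      have h2 := ih _ h1.1
      have h3 : |Z u ω - Z (par j u) ω| ≤ c * (m + j + 1) * (2 * √δ / 2 ^ j) := by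
        by_contra! hcon
        exact hω (Set.mem_iUnion.2 ⟨j, Set.mem_iUnion₂.2 ⟨u, hu, hcon.le⟩⟩)
      have h4 : c * (m + j + 1) * (2 * √δ / 2 ^ j) ≤
          2 * √δ * c * (m + 1) * ((j + 1) / 2 ^ j) := by
        have h5 : (m + j + 1 : ℝ) ≤ (m + 1) * (j + 1) := by
          nlinarith [mul_nonneg (Nat.cast_nonneg (α := ℝ) m) (Nat.cast_nonneg (α := ℝ) j)]
        calc c * (m + j + 1) * (2 * √δ / 2 ^ j) ≤ c * ((m + 1) * (j + 1)) * (2 * √δ / 2 ^ j) := by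
              gcongr
          _ = _ := by ring
      rw [← chain_sum_step, mul_add]
      exact (abs_sub_le _ (Z (par j u) ω) _).trans (by linarith)
  -- On the complement of the exceptional events, the bound passes to the limit along the nets.
  have hnull : ∀ u ∈ D, P ({ω | 9 * c * (m + 1) * √δ < |Z u ω - Z u₀ ω|} \ ⋃ j, F j) = 0 := by
    intro u hu
    have hε : 0 < c * (m + 1) := by positivity
    have hle : ∀ j : ℕ, P ({ω | 9 * c * (m + 1) * √δ < |Z u ω - Z u₀ ω|} \ ⋃ j, F j) ≤
        ENNReal.ofReal (4 * Real.exp (-(c * (m + 1) * 2 ^ j))) := by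
      intro j
      obtain ⟨v, hv, hlt⟩ := hNnet j u (hW.subset hu)
      have hσ : treeDist f u v ≤ (√δ / 2 ^ j) ^ 2 := by
        rw [div_pow, Real.sq_sqrt hδ.le, ← pow_mul, mul_comm j, pow_mul]
        norm_num
        exact hlt.le
      refine (measure_mono ?_).trans (hZ.measure_le_abs_sub (by positivity) hσ _)
      rintro ω ⟨hω, hωF⟩
      change 9 * c * (m + 1) * √δ < _ at hω
      change c * (m + 1) * 2 ^ j * (√δ / 2 ^ j) ≤ |Z u ω - Z v ω|
      have h1 := hchain ω hωF (j + 1) v (by rwa [hTs])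
      have h2 : 2 * √δ * c * (m + 1) * (4 - (2 * (j + 1 : ℕ) + 4) / 2 ^ (j + 1)) ≤
          2 * √δ * c * (m + 1) * 4 := by
        gcongr
        have : (0 : ℝ) ≤ (2 * (j + 1 : ℕ) + 4) / 2 ^ (j + 1) := by positivity
        linarith
      have h3 := abs_sub_le (Z u ω) (Z v ω) (Z u₀ ω)
      have h4 : c * (m + 1) * 2 ^ j * (√δ / 2 ^ j) = c * (m + 1) * √δ := by field_simp
      rw [h4]
      linarith
    have htend : Filter.Tendsto (fun j : ℕ =>
        ENNReal.ofReal (4 * Real.exp (-(c * (m + 1) * 2 ^ j)))) Filter.atTop (nhds 0) := by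
      have h1 : Filter.Tendsto (fun j : ℕ => c * (m + 1) * (2 : ℝ) ^ j) Filter.atTop
          Filter.atTop :=
        (tendsto_pow_atTop_atTop_of_one_lt one_lt_two).const_mul_atTop hε
      have h2 := (Real.tendsto_exp_neg_atTop_nhds_zero.comp h1).const_mul 4
      rw [mul_zero] at h2
      simpa using ENNReal.tendsto_ofReal h2
    exact le_antisymm (ge_of_tendsto' htend hle) bot_le
  calc P (deviationEvent Z D u₀ (9 * c * (m + 1) * √δ))
      ≤ P ((⋃ j, F j) ∪ ⋃ u ∈ D, ({ω | 9 * c * (m + 1) * √δ < |Z u ω - Z u₀ ω|} \ ⋃ j, F j)) := by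
        refine measure_mono ?_
        rintro ω ⟨u, hu, hω⟩
        by_cases hωF : ω ∈ ⋃ j, F j
        · exact Or.inl hωF
        · exact Or.inr (Set.mem_iUnion₂.2 ⟨u, hu, hω, hωF⟩)
    _ ≤ P (⋃ j, F j) + 0 := by
        refine (measure_union_le _ _).trans (add_le_add le_rfl ?_)
        exact ((measure_biUnion_null_iff hW.countable).2 hnull).le
    _ ≤ ENNReal.ofReal (b / 4) := by rwa [add_zero]

/-- Some deviation bound holds, since the labels are almost surely continuous, hence bounded. -/
theorem IsTreeLabel.exists_deviation_pow_le (hZ : IsTreeLabel f Z P) {x y u₀ : unitInterval}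
    {D : Set unitInterval} {δ : ℝ} (hW : IsWindow f x y u₀ D δ) {b : ℝ} (hb : 0 < b) :
    ∃ m : ℕ, P (deviationEvent Z D u₀ (2 ^ m * √δ)) ≤ ENNReal.ofReal b := by
  have hsqrt : 0 < √δ := Real.sqrt_pos.2 hW.pos
  have hmeas : ∀ m : ℕ, NullMeasurableSet (deviationEvent Z D u₀ (2 ^ m * √δ)) P := by
    intro m
    have e : deviationEvent Z D u₀ (2 ^ m * √δ) =
        ⋃ u ∈ D, {ω | 2 ^ m * √δ < |Z u ω - Z u₀ ω|} := by
      ext ω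
      simp [deviationEvent]
    rw [e]
    exact NullMeasurableSet.biUnion hW.countable fun u _ =>
      nullMeasurableSet_lt aemeasurable_const (hZ.aemeasurable_sub u u₀).abs
  have hanti : Antitone fun m : ℕ => deviationEvent Z D u₀ (2 ^ m * √δ) := by
    rintro m n hmn ω ⟨u, hu, hω⟩
    refine ⟨u, hu, lt_of_le_of_lt ?_ hω⟩
    gcongr
    norm_num
  have hinter : P (⋂ m : ℕ, deviationEvent Z D u₀ (2 ^ m * √δ)) = 0 := by
    refine measure_mono_null (fun ω hω => ?_) hZ.continuous
    intro hc
    obtain ⟨M, hM⟩ := isCompact_univ.exists_bound_of_continuousOn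
      (f := fun t => Z t ω - Z u₀ ω) (hc.sub continuous_const).continuousOn
    obtain ⟨m, hm⟩ := pow_unbounded_of_one_lt (M / √δ) (one_lt_two (α := ℝ))
    obtain ⟨u, -, hu⟩ := Set.mem_iInter.1 hω m
    have := hM u (Set.mem_univ u)
    rw [Real.norm_eq_abs] at this
    rw [div_lt_iff₀ hsqrt] at hm
    linarith
  have htend := tendsto_measure_iInter_atTop hmeas hanti ⟨0, measure_ne_top P _⟩
  rw [hinter] at htend
  obtain ⟨m, hm⟩ := (htend.eventually_lt_const (ENNReal.ofReal_pos.2 hb)).exists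
  exact ⟨m, hm.le⟩

/-- If there are no near-simplices of size `N` with positive probability, then the tree has uniformly bounded
covering numbers: a window cannot contain many points at mutual distances comparable to the
oscillation of `f`. -/
theorem IsTreeLabel.exists_uniform_card_le (hf : IsExcursion f) (hZ : IsTreeLabel f Z P) (N : ℕ)
    (hN : P (noNearSimplexEvent f Z N) ≠ 0) :
    ∃ n : ℕ, ∀ (x y u₀ : unitInterval) (D : Set unitInterval) (δ : ℝ),
      IsWindow f x y u₀ D δ → ∀ S : Finset unitInterval, (∀ u ∈ S, u ∈ Set.Icc x y) →
        (∀ u ∈ S, ∀ v ∈ S, u ≠ v → δ / 4 ≤ treeDist f u v) → S.card ≤ n := by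
  classical
  set b := (P (noNearSimplexEvent f Z N)).toReal with hb
  have hb0 : 0 < b := ENNReal.toReal_pos hN (measure_ne_top _ _)
  obtain ⟨B, hB, hcard⟩ := hZ.exists_card_le hf N hb0
    (by rw [hb, ENNReal.ofReal_toReal (measure_ne_top _ _)])
  obtain ⟨C, hC, hdev⟩ := hZ.exists_deviation_le hb0 hB
  obtain ⟨M, hM⟩ : ∃ M : ℕ, ∀ m : ℕ, M ≤ m → C * (m + 2) ≤ 2 ^ m := by
    have h1 := tendsto_pow_const_div_const_pow_of_one_lt 1 (one_lt_two (α := ℝ))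
    have h2 := tendsto_pow_const_div_const_pow_of_one_lt 0 (one_lt_two (α := ℝ))
    have h3 := (h1.add (h2.const_mul 2)).const_mul C
    simp only [mul_zero, add_zero] at h3
    obtain ⟨M, hM⟩ := Filter.eventually_atTop.1 (h3.eventually_le_const one_pos)
    refine ⟨M, fun m hm => ?_⟩
    have := hM m hm
    rw [pow_one, pow_zero, mul_one_div, ← add_div, ← mul_div_assoc,
      div_le_one (by positivity)] at this
    exact this
  refine ⟨B ^ (M + 2), fun x y u₀ D δ hW S hSI hS => ?_⟩
  have hex := hZ.exists_deviation_pow_le hW (b := b / 4) (by positivity)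
  -- The least dyadic bound for the labels improves itself unless it is of bounded order.
  have hmin : Nat.find hex ≤ M := by
    by_contra! hcon
    obtain ⟨m, hm⟩ : ∃ m, Nat.find hex = m + 1 := ⟨Nat.find hex - 1, by omega⟩
    have h1 := hdev x y u₀ D δ hW (m + 1)
      (hcard x y u₀ D δ hW (m + 1) (hm ▸ Nat.find_spec hex))
    refine Nat.find_min hex (m := m) (by omega) ((measure_mono ?_).trans h1)
    rintro ω ⟨u, hu, hω⟩
    refine ⟨u, hu, lt_of_le_of_lt ?_ hω⟩
    gcongr
    have := hM m (by omega)
    push_cast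
    linarith
  have := hcard x y u₀ D δ hW _ (Nat.find_spec hex) 1 S hSI (by simpa using hS)
  exact this.trans (Nat.pow_le_pow_right hB (by omega))

end

/-! ### Zig-zag functions -/

theorem zigzag_peak {n k : ℕ} (hk : k < n) : zigzag n ((2 * k + 1) / (2 * n)) = 1 := by
  have hn : (0 : ℝ) < n := by exact_mod_cast (Nat.zero_le k).trans_lt hk
  have hk' : (k : ℝ) + 1 ≤ n := by exact_mod_cast hk
  unfold zigzag
  have e : (n : ℝ) * ((2 * k + 1) / (2 * n)) - 1 / 2 = k := by field_simp; ring
  rw [if_neg (by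
    rw [not_lt, div_le_div_iff_of_pos_right (by positivity)]
    linarith [(Nat.cast_nonneg k : (0 : ℝ) ≤ k)]), e, Int.floor_natCast]
  by_cases h : (2 * (n : ℝ) - 1) / (2 * n) ≤ (2 * k + 1) / (2 * n)
  · rw [if_pos h]
    rw [div_le_div_iff_of_pos_right (by positivity)] at h
    have : (k : ℝ) = n - 1 := by linarith
    rw [this]
    field_simp
    ring
  · rw [if_neg h, if_pos]
    · push_cast
      field_simp
      ring
    · push_cast
      rw [div_lt_div_iff₀ (by positivity) hn]
      nlinarith

theorem zigzag_valley {n k : ℕ} (hk : k + 1 < n) : zigzag n ((k + 1) / n) = 1 / 2 := by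
  have hn : (0 : ℝ) < n := by exact_mod_cast (Nat.zero_le _).trans_lt hk
  have hk' : (k : ℝ) + 2 ≤ n := by exact_mod_cast hk
  have hk0 : (0 : ℝ) ≤ k := Nat.cast_nonneg k
  unfold zigzag
  have e : (n : ℝ) * ((k + 1) / n) - 1 / 2 = k + 1 / 2 := by field_simp; ring
  have hfloor : ⌊(k : ℝ) + 1 / 2⌋ = k := by
    rw [Int.floor_eq_iff]
    push_cast
    constructor <;> linarith
  rw [if_neg (by
    rw [not_lt, div_le_div_iff₀ (by positivity) hn]
    nlinarith), if_neg (by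
    rw [not_le, div_lt_div_iff₀ hn (by positivity)]
    nlinarith), e, hfloor, if_neg (by push_cast; exact lt_irrefl _)]
  push_cast
  field_simp
  ring

theorem zigzag_mem_Icc {n : ℕ} (hn : 0 < n) {x : ℝ} (hx : x ∈ Set.Icc (0 : ℝ) 1) :
    zigzag n x ∈ Set.Icc (0 : ℝ) 1 := by
  have hn' : (0 : ℝ) < n := by exact_mod_cast hn
  obtain ⟨h0, h1⟩ := hx
  have hfl := Int.floor_le (n * x - 1 / 2)
  have hfl' := Int.lt_floor_add_one (n * x - 1 / 2)
  unfold zigzag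
  split_ifs with h h' h''
  · rw [lt_div_iff₀ (by positivity)] at h
    constructor
    · positivity
    · linarith
  · rw [div_le_iff₀ (by positivity)] at h'
    constructor <;> nlinarith
  · rw [lt_div_iff₀ hn'] at h''
    constructor <;> nlinarith
  · rw [not_lt, div_le_iff₀ hn'] at h''
    constructor <;> nlinarith

/-- A stretch on which `f` looks like the zig-zag function `F_n` contains `n` points of the tree
at mutual distances comparable to the oscillation of `f`: the peaks of the zig-zag. -/
theorem IsZigzagOn.exists_window {f : C(unitInterval, ℝ)} {n : ℕ} (hn : 4 ≤ n)
    {s t : unitInterval} (h : IsZigzagOn f n s t) :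
    ∃ (D : Set unitInterval) (δ : ℝ), IsWindow f s t s D δ ∧ ∃ S : Finset unitInterval,
      S.card = n ∧ (∀ u ∈ S, u ∈ Set.Icc s t) ∧
        ∀ u ∈ S, ∀ v ∈ S, u ≠ v → δ / 4 ≤ treeDist f u v := by
  classical
  obtain ⟨hst, happ⟩ := h
  have hn0 : (0 : ℝ) < n := by exact_mod_cast (by omega : 0 < n)
  set L : ℝ := (t : ℝ) - s with hL
  have hLpos : 0 < L := sub_pos.2 hst
  have hsqrt : 0 < √L := Real.sqrt_pos.2 hLpos
  have hε : (2 : ℝ) ^ (1 - (n : ℤ)) ≤ 1 / 8 := by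
    calc (2 : ℝ) ^ (1 - (n : ℤ)) ≤ 2 ^ (-3 : ℤ) :=
          zpow_le_zpow_right₀ (by norm_num) (by omega)
      _ = 1 / 8 := by norm_num
  -- The time at proportion `r` of the interval.
  set φ : ℝ → unitInterval := fun r => Set.projIcc 0 1 zero_le_one (s + L * r)
  have hφ : ∀ r ∈ Set.Icc (0 : ℝ) 1, (φ r : ℝ) = s + L * r := fun r hr => by
    have h1 : (s : ℝ) + L * r ∈ Set.Icc (0 : ℝ) 1 := by
      have h2 := s.2.1
      have h3 := t.2.2
      constructor
      · nlinarith [mul_nonneg hLpos.le hr.1]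
      · nlinarith [hr.2]
    simp only [φ, Set.projIcc_of_mem _ h1]
  have hφI : ∀ r ∈ Set.Icc (0 : ℝ) 1, φ r ∈ Set.Icc s t := fun r hr => by
    rw [Set.mem_Icc, ← Subtype.coe_le_coe, ← Subtype.coe_le_coe, hφ r hr]
    constructor <;> nlinarith [hr.1, hr.2]
  have hval : ∀ r ∈ Set.Icc (0 : ℝ) 1, |f (φ r) - f s - √L * zigzag n r| ≤ √L / 8 := by
    intro r hr
    have h1 := (happ (φ r) (hφI r hr)).le
    have e : ((φ r : ℝ) - s) / L = r := by
      rw [hφ r hr]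
      field_simp
      ring
    rw [e] at h1
    exact h1.trans (by nlinarith)
  have hpeak_mem : ∀ k < n, (2 * k + 1 : ℝ) / (2 * n) ∈ Set.Icc (0 : ℝ) 1 := fun k hk => by
    have : (k : ℝ) + 1 ≤ n := by exact_mod_cast hk
    refine ⟨by positivity, (div_le_one (by positivity)).2 (by linarith)⟩
  have hlt : ∀ i j, i < j → j < n →
      φ ((2 * i + 1) / (2 * n)) ≠ φ ((2 * j + 1) / (2 * n)) ∧
        √L / 2 ≤ treeDist f (φ ((2 * i + 1) / (2 * n))) (φ ((2 * j + 1) / (2 * n))) := by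
    intro i j hij hj
    have hin : i + 1 < n := by omega
    have hi' := hpeak_mem i (by omega)
    have hj' := hpeak_mem j hj
    have hij' : (i : ℝ) + 1 ≤ j := by exact_mod_cast hij
    have hin' : (i : ℝ) + 1 ≤ n := by exact_mod_cast hin.le
    have hv' : ((i : ℝ) + 1) / n ∈ Set.Icc (0 : ℝ) 1 := by
      refine ⟨by positivity, (div_le_one hn0).2 hin'⟩
    have h1 : ((2 * i + 1 : ℝ)) / (2 * n) < (i + 1) / n := by
      rw [div_lt_div_iff₀ (by positivity) hn0]
      nlinarith
    have h2 : ((i : ℝ) + 1) / n < (2 * j + 1) / (2 * n) := by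
      rw [div_lt_div_iff₀ hn0 (by positivity)]
      nlinarith
    have hmono : ∀ r ∈ Set.Icc (0 : ℝ) 1, ∀ r' ∈ Set.Icc (0 : ℝ) 1, r < r' → φ r < φ r' := by
      intro r hr r' hr' hrr
      rw [← Subtype.coe_lt_coe, hφ r hr, hφ r' hr']
      nlinarith
    have h3 := hmono _ hi' _ hv' h1
    have h4 := hmono _ hv' _ hj' h2
    refine ⟨(h3.trans h4).ne, ?_⟩
    have hmin := minBetween_le f (Set.mem_uIcc_of_le h3.le h4.le)
    have e1 := abs_le.1 (hval _ hi')
    have e2 := abs_le.1 (hval _ hj')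
    have e3 := abs_le.1 (hval _ hv')
    rw [zigzag_peak (by omega)] at e1
    rw [zigzag_peak hj] at e2
    rw [zigzag_valley hin] at e3
    unfold treeDist
    linarith [e1.1, e2.1, e3.2]
  obtain ⟨D, hDc, hD⟩ := TopologicalSpace.exists_countable_dense (Set.Icc s t)
  refine ⟨(↑) '' D, 2 * √L, ⟨by positivity, Set.left_mem_Icc.2 hst.le, hDc.image _, ?_,
    Subtype.dense_iff.1 hD, f s - √L / 2, fun u hu => ?_⟩,
    (Finset.range n).image fun k : ℕ => φ ((2 * k + 1) / (2 * n)), ?_, ?_, ?_⟩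
  · rintro _ ⟨u, -, rfl⟩
    exact u.2
  · have hu' : ((u : ℝ) - s) / L ∈ Set.Icc (0 : ℝ) 1 := by
      have h1 : (s : ℝ) ≤ u := hu.1
      have h2 : (u : ℝ) ≤ t := hu.2
      refine ⟨div_nonneg (by linarith) hLpos.le, (div_le_one hLpos).2 (by linarith)⟩
    have h1 := abs_lt.1 (happ u hu)
    have h2 := zigzag_mem_Icc (n := n) (by omega) hu'
    have h3 := mul_nonneg hsqrt.le h2.1
    have h4 := mul_le_mul_of_nonneg_left h2.2 hsqrt.le
    have h5 := mul_le_mul_of_nonneg_left hε hsqrt.le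
    constructor <;> linarith
  · rw [Finset.card_image_of_injOn, Finset.card_range]
    intro i hi j hj hij
    rw [Finset.coe_range, Set.mem_Iio] at hi hj
    rcases lt_trichotomy i j with h | h | h
    · exact absurd hij (hlt i j h hj).1
    · exact h
    · exact absurd hij.symm (hlt j i h hi).1
  · intro u hu
    obtain ⟨k, hk, rfl⟩ := Finset.mem_image.1 hu
    exact hφI _ (hpeak_mem k (Finset.mem_range.1 hk))
  · intro u hu v hv huv
    obtain ⟨i, hi, rfl⟩ := Finset.mem_image.1 hu
    obtain ⟨j, hj, rfl⟩ := Finset.mem_image.1 hv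
    rw [Finset.mem_range] at hi hj
    have e : 2 * √L / 4 = √L / 2 := by ring
    rw [e]
    rcases lt_trichotomy i j with h | h | h
    · exact (hlt i j h hj).2
    · exact absurd (by rw [h]) huv
    · rw [treeDist_comm]
      exact (hlt j i h hi).2

theorem theorem4 (f : C(unitInterval, ℝ)) (hf : IsExcursion f)
    (hzig : {n : ℕ | ∃ s t : ℕ → unitInterval,
      (∀ k, IsZigzagOn f n (s k) (t k)) ∧
      (∀ j k, j ≠ k → Disjoint (Set.Icc (s j) (t j)) (Set.Icc (s k) (t k)))}.Infinite)
    {Ω : Type*} [MeasurableSpace Ω] (P : Measure Ω) [IsProbabilityMeasure P]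
    (Z : unitInterval → Ω → ℝ) (hZ : IsTreeLabel f Z P) :
    ∀ᵐ ω ∂P, ∃ hc : Continuous fun t => Z t ω,
      Starry (BrownianMap f ⟨fun t => Z t ω, hc⟩) := by
  have hnull : ∀ N, P (noNearSimplexEvent f Z N) = 0 := by
    intro N
    by_contra hN
    obtain ⟨n, hn⟩ := hZ.exists_uniform_card_le hf N hN
    obtain ⟨m, ⟨s, t, hzz, -⟩, hm⟩ := hzig.exists_gt (n + 4)
    obtain ⟨D, δ, hW, S, hcard, hSI, hS⟩ := (hzz 0).exists_window (by omega)
    have := hn _ _ _ _ _ hW S hSI hS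
    omega
  have hall : ∀ᵐ ω ∂P, ∀ N, ω ∉ noNearSimplexEvent f Z N :=
    ae_all_iff.2 fun N => measure_eq_zero_iff_ae_notMem.1 (hnull N)
  filter_upwards [hZ.continuous, hZ.ae_labelCompatible, hall] with ω hc hcompat hN
  exact ⟨hc, starry_of_nearSimplices hf (hcompat hc) fun N h =>
    hN N ⟨_, fun _ => rfl, hcompat hc, h⟩⟩
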